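/- **Setting.** Let $T>0$, let $Z,V$ be real Hilbert spaces and $X$ a real Banach space with continuous embeddings $Z\hookrightarrow V\hookrightarrow X$, where $Z\hookrightarrow V$ is compact and dense; functionals in $V^*$ are also regarded as functionals in $Z^*$ by restriction. Let $$I:[0,T]\times Z\to\mathbb R,\qquad I(t,z)=\tfrac12\langle Az,z\rangle_{Z^*,Z}+F(z)-\langle \ell(t),z\rangle_{V^*,V},$$ where $A\in L(Z,Z^*)$ is self-adjoint and coercive ($\langle Az,z\rangle\ge\alpha\|z\|_Z^2$ for some $\alpha>0$), $\ell\in C^{0,1}([0,T];V^*)$, and $F\in C^2(Z;\mathbb R)$ satisfies $F\ge 0$, $D_zF\in C^1(Z,V^*)$ and $\|D_z^2F(z)v\|_{V^*}\le C_F(1+\|z\|_Z^q)\|v\|_Z$ for all $z,v\in Z$, with some $q\ge1$ and some constant $C_F$. Assume moreover that $I(t,\cdot)\in C^{2,1}_{\mathrm{loc}}(Z;\mathbb R)$, i.e. for every $t\in[0,T]$ and $r>0$ there is $C(r)\ge0$ with $\langle[D_z^2I(t,z_1)-D_z^2I(t,z_2)]v,v\rangle\le C(r)\|z_1-z_2\|_Z\|v\|_Z^2$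 for all $z_1,z_2\in B_Z(0,r)$ and $v\in Z$. Let $R:V\to[0,\infty)$ be lower semicontinuous, convex and positively homogeneous of degree one, with $\underline\rho\|v\|_X\le R(v)\le\overline\rho\|v\|_V$ for all $v\in V$ and some $\underline\rho,\overline\rho>0$. Let $\partial R$ denote its convex subdifferential, and let $z_0\in Z$ be locally stable, i.e. $0\in\partial R(0)+D_zI(0,z_0)$. A *differential solution* is a (continuous) function $z\in W^{1,1}(0,T;Z)$ with $z(0)=z_0$ and $0\in\partial R(z'(t))+D_zI(t,z(t))$ in $Z^*$ for almost all $t\in[0,T]$. **Theorem B.1.** Suppose that $I$ is $\kappa$-uniformly convex for some $\kappa>0$, i.e. $\langle D_z^2I(t,z)v,v\rangle_{Z^*,Z}\ge\kappa\|v\|_Z^2$ for all $t\in[0,T]$ and all $z,v\in Z$. Then there exists a unique differential solution $z$, and it belongs to $W^{1,\infty}(0,T;Z)$. (Uniqueness holds among all differential solutions, i.e. in $W^{1,1}(0,T;Z)$.) -/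

import Mathlib

open MeasureTheory Set
open scoped Pointwise

namespace RateIndependent

/-- The convex subdifferential `∂f(u)` of a real function on a real normed space,
as a subset of the dual space. -/
def subdifferential {E : Type*} [NormedAddCommGroup E] [NormedSpace ℝ E]
    (f : E → ℝ) (u : E) : Set (StrongDual ℝ E) :=
  {ξ | ∀ w : E, f u + ξ (w - u) ≤ f w}

section Sobolev

variable {E : Type*} [NormedAddCommGroup E] [NormedSpace ℝ E]

/-- `g` is a weak derivative of `z` on the interval `(0,T)`, tested with scalar functions in
`C_c^∞(0,T)`. -/
def IsWeakDeriv (T : ℝ) (z g : ℝ → E) : Prop :=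
  ∀ φ : ℝ → ℝ, ContDiff ℝ ((⊤ : ℕ∞) : WithTop ℕ∞) φ → HasCompactSupport φ →
    tsupport φ ⊆ Ioo 0 T →
    ∫ t in Ioo 0 T, deriv φ t • z t = - ∫ t in Ioo 0 T, φ t • g t

/-- `z ∈ W^{1,p}(0,T;E)` with weak derivative `g`. -/
structure IsSobolevWithDeriv (p : ENNReal) (T : ℝ) (z g : ℝ → E) : Prop where
  memLp : MemLp z p (volume.restrict (Ioo 0 T))
  memLp_deriv : MemLp g p (volume.restrict (Ioo 0 T))
  isWeakDeriv : IsWeakDeriv T z g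

/-- `z ∈ W^{1,p}(0,T;E)`. -/
def MemSobolev (p : ENNReal) (T : ℝ) (z : ℝ → E) : Prop :=
  ∃ g : ℝ → E, IsSobolevWithDeriv p T z g

end Sobolev

section System

variable {Z V X : Type*}
  [NormedAddCommGroup Z] [InnerProductSpace ℝ Z]
  [NormedAddCommGroup V] [InnerProductSpace ℝ V]
  [NormedAddCommGroup X] [NormedSpace ℝ X]

/-- `Z` is compactly and densely embedded in `V` (by `ι`), and `V` is continuously embedded in
`X` (by `j`). -/
structure IsEmbeddingChain (ι : Z →L[ℝ] V) (j : V →L[ℝ] X) : Prop where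
  injective_left : Function.Injective ι
  compact_left : IsCompactOperator ι
  dense_left : DenseRange ι
  injective_right : Function.Injective j

/-- The semilinear energy `I(t,z) = ½⟨Az,z⟩ + F(z) - ⟨ℓ(t),z⟩`. -/
noncomputable def energy (ι : Z →L[ℝ] V) (A : Z →L[ℝ] StrongDual ℝ Z) (F : Z → ℝ)
    (ℓ : ℝ → StrongDual ℝ V) (t : ℝ) (z : Z) : ℝ :=
  (1 / 2 : ℝ) * A z z + F z - ℓ t (ι z)

/-- The derivative `D_z I(t,z) ∈ Z*`. -/
noncomputable def energyDeriv (ι : Z →L[ℝ] V) (A : Z →L[ℝ] StrongDual ℝ Z) (F : Z → ℝ)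
    (ℓ : ℝ → StrongDual ℝ V) (t : ℝ) (z : Z) : StrongDual ℝ Z :=
  fderiv ℝ (energy ι A F ℓ t) z

/-- The second derivative `D_z² I(t,z) ∈ L(Z,Z*)`. -/
noncomputable def energyDeriv2 (ι : Z →L[ℝ] V) (A : Z →L[ℝ] StrongDual ℝ Z) (F : Z → ℝ)
    (ℓ : ℝ → StrongDual ℝ V) (t : ℝ) (z : Z) : Z →L[ℝ] StrongDual ℝ Z :=
  fderiv ℝ (energyDeriv ι A F ℓ t) z

/-- The standing assumptions on the ingredients of the energy. -/
structure IsAdmissibleEnergy (ι : Z →L[ℝ] V) (A : Z →L[ℝ] StrongDual ℝ Z) (F : Z → ℝ)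
    (ℓ : ℝ → StrongDual ℝ V) (T : ℝ) : Prop where
  /-- `A` is self-adjoint. -/
  symm : ∀ u v : Z, A u v = A v u
  /-- `A` is coercive. -/
  coercive : ∃ α : ℝ, 0 < α ∧ ∀ z : Z, α * ‖z‖ ^ 2 ≤ A z z
  /-- `ℓ ∈ C^{0,1}([0,T];V*)`. -/
  lipschitz_load : ∃ L : NNReal, LipschitzOnWith L ℓ (Icc 0 T)
  /-- `F ∈ C²(Z;ℝ)`. -/
  contDiff : ContDiff ℝ 2 F
  nonneg : ∀ z : Z, 0 ≤ F z
  /-- `D_z F ∈ C¹(Z,V*)`, with the growth bound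
  `‖D_z² F(z)v‖_{V*} ≤ C (1 + ‖z‖^q) ‖v‖` for some `q ≥ 1`;
  here `G` is `D_z F` as a map with values in `V*`. -/
  lower_order : ∃ G : Z → StrongDual ℝ V, ContDiff ℝ 1 G ∧
    (∀ z : Z, (G z).comp ι = fderiv ℝ F z) ∧
    ∃ C q : ℝ, 1 ≤ q ∧ ∀ z v : Z, ‖fderiv ℝ G z v‖ ≤ C * (1 + ‖z‖ ^ q) * ‖v‖
  /-- `I(t,·) ∈ C^{2,1}_loc(Z;ℝ)`. -/
  locLipschitz : ∀ t ∈ Icc 0 T, ∀ r : ℝ, 0 < r → ∃ C : ℝ, 0 ≤ C ∧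
    ∀ z₁ ∈ Metric.ball (0 : Z) r, ∀ z₂ ∈ Metric.ball (0 : Z) r, ∀ v : Z,
      (energyDeriv2 ι A F ℓ t z₁ - energyDeriv2 ι A F ℓ t z₂) v v ≤ C * ‖z₁ - z₂‖ * ‖v‖ ^ 2

/-- The energy is `κ`-uniformly convex. -/
def IsUniformlyConvex (ι : Z →L[ℝ] V) (A : Z →L[ℝ] StrongDual ℝ Z) (F : Z → ℝ)
    (ℓ : ℝ → StrongDual ℝ V) (T κ : ℝ) : Prop :=
  0 < κ ∧ ∀ t ∈ Icc 0 T, ∀ z v : Z, κ * ‖v‖ ^ 2 ≤ energyDeriv2 ι A F ℓ t z v v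

/-- The standing assumptions on the dissipation potential `R : V → [0,∞)`. -/
structure IsAdmissibleDissipation (j : V →L[ℝ] X) (R : V → ℝ) : Prop where
  nonneg : ∀ v : V, 0 ≤ R v
  lowerSemicontinuous : LowerSemicontinuous R
  convex : ConvexOn ℝ univ R
  posHomogeneous : ∀ c : ℝ, 0 < c → ∀ v : V, R (c • v) = c * R v
  bounded : ∃ ρ₁ ρ₂ : ℝ, 0 < ρ₁ ∧ 0 < ρ₂ ∧ ∀ v : V, ρ₁ * ‖j v‖ ≤ R v ∧ R v ≤ ρ₂ * ‖v‖

/-- The inclusion `0 ∈ ∂R(w) + D_z I(t,z)` in `Z*`, where `w, z ∈ Z` and `∂R(w) ⊆ V*` is regarded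
as a subset of `Z*` by restriction of functionals along the embedding `ι`. -/
def Inclusion (ι : Z →L[ℝ] V) (A : Z →L[ℝ] StrongDual ℝ Z) (F : Z → ℝ)
    (ℓ : ℝ → StrongDual ℝ V) (R : V → ℝ) (t : ℝ) (w z : Z) : Prop :=
  (0 : StrongDual ℝ Z) ∈
    (fun ξ : StrongDual ℝ V => ξ.comp ι) '' subdifferential R (ι w) + {energyDeriv ι A F ℓ t z}

/-- `z : [0,T] → Z` is a differential solution with initial value `z₀`: `z ∈ W^{1,1}(0,T;Z)`
(continuous representative), `z(0) = z₀` and `0 ∈ ∂R(z'(t)) + D_z I(t,z(t))` for almost all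
`t ∈ (0,T)`. Only the values of `z` on `[0,T]` matter. -/
structure IsDifferentialSolution (ι : Z →L[ℝ] V) (A : Z →L[ℝ] StrongDual ℝ Z) (F : Z → ℝ)
    (ℓ : ℝ → StrongDual ℝ V) (R : V → ℝ) (T : ℝ) (z₀ : Z) (z : ℝ → Z) : Prop where
  continuousOn : ContinuousOn z (Icc 0 T)
  initial : z 0 = z₀
  inclusion : ∃ z' : ℝ → Z, IsSobolevWithDeriv 1 T z z' ∧
    ∀ᵐ t ∂(volume.restrict (Ioo 0 T)), Inclusion ι A F ℓ R t (z' t) (z t)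

end System

end RateIndependent

/-! Write `B z = A z + DF(z)`, `l t = ℓ(t) ∘ ι`, `Ψ = R ∘ ι`. By Hahn–Banach the inclusion is
equivalent to `l t - B z ∈ ∂Ψ(z')` in `Z*` (`inclusion_iff`). Uniform convexity makes `B` strongly
monotone; its derivative is symmetric and locally Lipschitz.

The engine is the Mielke–Theil estimate `IsEllipticOperator.stability`. For two curves, `γ = ⟨B z₁ -
B z₂, z₁ - z₂⟩` dominates `κ‖z₁ - z₂‖²`, and symmetry of `DB` with a second order Taylor estimate
gives `γ' ≤ 2⟨B z₁ - B z₂, z₁' - z₂'⟩ + (C/κ)(‖z₁'‖ + ‖z₂'‖) γ`. Monotonicity of `∂Ψ` makes the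
first term nonpositive for solutions and small for approximate ones, so Gronwall yields both
uniqueness in `W^{1,1}` and the Cauchy property of approximations.

Existence uses implicit Euler minimisation. Strong monotonicity bounds each increment by `(L/κ)τ`
(`norm_increment_le`), so the affine interpolants are equi-Lipschitz and solve the inclusion up to
`O(τ)`. They converge uniformly to a Lipschitz limit `y`, whose derivative is a weak `L²` limit.
With `ξ = l - B y`, membership in `∂Ψ(y')` splits into `ξ ≤ Ψ`, which passes to the limit, and
`Ψ(y') ≤ ξ(y')`, obtained at points of differentiability by testing with a functional supporting `Ψ`
at `y'`. -/

open Filter Topology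

/-! ### Absolutely continuous functions and Gronwall's inequality. -/

/-- A function whose increments are controlled by those of an absolutely continuous function is
absolutely continuous. -/
theorem AbsolutelyContinuousOnInterval.of_dist_le {X Y : Type*} [PseudoMetricSpace X]
    [PseudoMetricSpace Y] {f : ℝ → X} {M : ℝ → Y} {a b C : ℝ}
    (hM : AbsolutelyContinuousOnInterval M a b)
    (h : ∀ x ∈ uIcc a b, ∀ y ∈ uIcc a b, dist (f x) (f y) ≤ C * dist (M x) (M y)) :
    AbsolutelyContinuousOnInterval f a b := by
  rw [absolutelyContinuousOnInterval_iff] at hM ⊢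
  intro ε hε
  have hC : 0 < |C| + 1 := by positivity
  obtain ⟨δ, hδ, H⟩ := hM (ε / (|C| + 1)) (by positivity)
  refine ⟨δ, hδ, fun E hE hlen => ?_⟩
  calc ∑ i ∈ Finset.range E.1, dist (f (E.2 i).1) (f (E.2 i).2)
      ≤ ∑ i ∈ Finset.range E.1, (|C| + 1) * dist (M (E.2 i).1) (M (E.2 i).2) := by
        refine Finset.sum_le_sum fun i hi => (h _ (hE.1 i hi).1 _ (hE.1 i hi).2).trans ?_
        gcongr
        linarith [le_abs_self C]
    _ = (|C| + 1) * ∑ i ∈ Finset.range E.1, dist (M (E.2 i).1) (M (E.2 i).2) := by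
        rw [Finset.mul_sum]
    _ < (|C| + 1) * (ε / (|C| + 1)) := by
        gcongr
        exact H E hE hlen
    _ = ε := by field_simp

theorem AbsolutelyContinuousOnInterval.le_of_ae_deriv_nonpos {f : ℝ → ℝ} {a b : ℝ} (hab : a ≤ b)
    (hf : AbsolutelyContinuousOnInterval f a b)
    (h : ∀ᵐ x, x ∈ Ioo a b → deriv f x ≤ 0) : f b ≤ f a := by
  have h1 : ∫ x in a..b, deriv f x ≤ 0 := by
    rw [intervalIntegral.integral_of_le hab, integral_Ioc_eq_integral_Ioo]
    exact integral_nonpos_of_ae ((ae_restrict_iff' measurableSet_Ioo).2 h)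
  linarith [hf.integral_deriv_eq_sub]

/-- Gronwall's inequality for absolutely continuous functions, with an integrable coefficient. -/
theorem AbsolutelyContinuousOnInterval.gronwall {γ m : ℝ → ℝ} {T ε : ℝ} (hT : 0 ≤ T)
    (hε : 0 ≤ ε) (hγ : AbsolutelyContinuousOnInterval γ 0 T) (hm : IntervalIntegrable m volume 0 T)
    (hm0 : ∀ t, 0 ≤ m t) (hγ0 : γ 0 = 0)
    (h : ∀ᵐ t, t ∈ Ioo 0 T → ∃ γ' : ℝ, HasDerivAt γ γ' t ∧ γ' ≤ ε + m t * γ t) :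
    γ T ≤ ε * T * Real.exp (∫ s in 0..T, m s) := by
  set M : ℝ → ℝ := fun t => ∫ s in 0..t, m s with hMdef
  have hM : AbsolutelyContinuousOnInterval M 0 T :=
    hm.absolutelyContinuousOnInterval_intervalIntegral (by simp)
  have hMnonneg : ∀ t ∈ uIcc 0 T, 0 ≤ M t := fun t ht => by
    rw [uIcc_of_le hT] at ht
    exact intervalIntegral.integral_nonneg ht.1 fun s _ => hm0 s
  -- `exp(-·)` is 1-Lipschitz on `[0, ∞)`, and `M ≥ 0`.
  have hexp : AbsolutelyContinuousOnInterval (fun t => Real.exp (-M t)) 0 T := by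
    refine hM.of_dist_le (C := 1) fun x hx y hy => ?_
    have key : ∀ a b : ℝ, 0 ≤ a → a ≤ b → |Real.exp (-a) - Real.exp (-b)| ≤ b - a := by
      intro a b ha hab
      have h1 : Real.exp (-b) ≤ Real.exp (-a) := by gcongr
      have h2 : Real.exp (-b) = Real.exp (-a) * Real.exp (-(b - a)) := by
        rw [← Real.exp_add]; ring_nf
      have h3 : 1 - (b - a) ≤ Real.exp (-(b - a)) := by
        linarith [Real.add_one_le_exp (-(b - a))]
      have h4 : Real.exp (-a) ≤ 1 := Real.exp_le_one_iff.2 (by linarith)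
      have h5 := Real.exp_pos (-a)
      rw [abs_of_nonneg (by linarith), h2]
      nlinarith
    rw [Real.dist_eq, Real.dist_eq, one_mul]
    rcases le_total (M x) (M y) with hxy | hxy
    · rw [abs_sub_comm (M x), abs_of_nonneg (sub_nonneg.2 hxy)]
      exact key _ _ (hMnonneg x hx) hxy
    · rw [abs_of_nonneg (sub_nonneg.2 hxy), abs_sub_comm]
      exact key _ _ (hMnonneg y hy) hxy
  have hlin : AbsolutelyContinuousOnInterval (fun t : ℝ => ε * t) 0 T :=
    (ContDiff.contDiffOn (by fun_prop)).absolutelyContinuousOnInterval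
  -- Integrating factor: `exp(-M) γ - ε t` has derivative at most `ε (exp(-M) - 1) ≤ 0`.
  have hu := (hexp.mul hγ).sub hlin
  have hle := hu.le_of_ae_deriv_nonpos hT (by
    filter_upwards [h, hm.ae_hasDerivAt_integral] with t ht1 ht2 ht
    obtain ⟨γ', hγ', hb⟩ := ht1 ht
    have htI : t ∈ uIcc 0 T := by rw [uIcc_of_le hT]; exact Ioo_subset_Icc_self ht
    have hMt : HasDerivAt M (m t) t := ht2 htI 0 (by simp)
    have hd := (hMt.neg.exp.mul hγ').sub ((hasDerivAt_id t).const_mul ε)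
    have heq : deriv ((fun t => Real.exp (-M t)) * γ - fun t => ε * t) t = _ := hd.deriv
    rw [heq]
    have h1 : Real.exp (-M t) ≤ 1 := Real.exp_le_one_iff.2 (by linarith [hMnonneg t htI])
    have h2 := Real.exp_pos (-M t)
    simp only [Pi.neg_apply] at *
    nlinarith [mul_le_mul_of_nonneg_left hb h2.le])
  simp only [Pi.sub_apply, Pi.mul_apply, hγ0, mul_zero, sub_zero, sub_nonpos] at hle
  have h1 : γ T = Real.exp (M T) * (Real.exp (-M T) * γ T) := by
    rw [← mul_assoc, ← Real.exp_add]; simp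
  rw [h1, mul_comm (ε * T)]
  gcongr

namespace RateIndependent

/-! ### Continuous Sobolev functions are primitives. -/

section Primitive

variable {E : Type*} [NormedAddCommGroup E] [NormedSpace ℝ E]

/-- On `[0,T]` the function `z` is a primitive of the integrable function `g`. -/
structure IsPrimitiveOn (T : ℝ) (z g : ℝ → E) : Prop where
  intervalIntegrable : IntervalIntegrable g volume 0 T
  eq_integral : ∀ t ∈ Icc 0 T, z t = z 0 + ∫ s in 0..t, g s

namespace IsPrimitiveOn

variable {T : ℝ} {z g : ℝ → E}

theorem intervalIntegrable_of_mem (h : IsPrimitiveOn T z g) {s t : ℝ} (hs : s ∈ Icc 0 T)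
    (ht : t ∈ Icc 0 T) : IntervalIntegrable g volume s t :=
  h.intervalIntegrable.mono_set (by
    rw [uIcc_of_le (hs.1.trans hs.2)]
    exact uIcc_subset_Icc hs ht)

theorem sub_eq_integral (h : IsPrimitiveOn T z g) {s t : ℝ} (hs : s ∈ Icc 0 T)
    (ht : t ∈ Icc 0 T) : z t - z s = ∫ r in s..t, g r := by
  have h0 : (0 : ℝ) ∈ Icc 0 T := ⟨le_rfl, hs.1.trans hs.2⟩
  rw [h.eq_integral t ht, h.eq_integral s hs, add_sub_add_left_eq_sub,
    intervalIntegral.integral_interval_sub_left (h.intervalIntegrable_of_mem h0 ht)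
      (h.intervalIntegrable_of_mem h0 hs)]

theorem norm (h : IsPrimitiveOn T z g) :
    IsPrimitiveOn T (fun t => ∫ s in 0..t, ‖g s‖) (fun t => ‖g t‖) :=
  ⟨h.intervalIntegrable.norm, fun t _ => by simp⟩

theorem dist_le (h : IsPrimitiveOn T z g) {s t : ℝ} (hs : s ∈ Icc 0 T) (ht : t ∈ Icc 0 T) :
    dist (z s) (z t) ≤ dist (∫ r in 0..s, ‖g r‖) (∫ r in 0..t, ‖g r‖) := by
  rw [dist_comm, dist_comm (∫ r in 0..s, ‖g r‖), dist_eq_norm, dist_eq_norm,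
    h.sub_eq_integral hs ht, h.norm.sub_eq_integral hs ht]
  exact intervalIntegral.norm_integral_le_abs_integral_norm

theorem absolutelyContinuousOnInterval (hT : 0 ≤ T) (h : IsPrimitiveOn T z g) :
    AbsolutelyContinuousOnInterval z 0 T := by
  refine (h.intervalIntegrable.norm.absolutelyContinuousOnInterval_intervalIntegral
    (c := 0) (by simp)).of_dist_le (C := 1) fun x hx y hy => ?_
  rw [uIcc_of_le hT] at hx hy
  rw [one_mul]
  exact h.dist_le hx hy

theorem continuousOn (hT : 0 ≤ T) (h : IsPrimitiveOn T z g) : ContinuousOn z (Icc 0 T) := by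
  simpa [uIcc_of_le hT] using (h.absolutelyContinuousOnInterval hT).continuousOn

theorem ae_hasDerivAt [CompleteSpace E] (h : IsPrimitiveOn T z g) :
    ∀ᵐ t, t ∈ Ioo 0 T → HasDerivAt z (g t) t := by
  filter_upwards [h.intervalIntegrable.ae_hasDerivAt_integral] with t ht htT
  have hT : 0 ≤ T := htT.1.le.trans htT.2.le
  have h1 := (ht (by rw [uIcc_of_le hT]; exact Ioo_subset_Icc_self htT) 0 (by simp)).const_add (z 0)
  refine h1.congr_of_eventuallyEq ?_
  filter_upwards [Ioo_mem_nhds htT.1 htT.2] with s hs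
  exact h.eq_integral s (Ioo_subset_Icc_self hs)

theorem integrable (hT : 0 ≤ T) (h : IsPrimitiveOn T z g) :
    Integrable g (volume.restrict (Ioo 0 T)) := by
  have := (intervalIntegrable_iff_integrableOn_Ioc_of_le hT).1 h.intervalIntegrable
  exact this.mono_set Ioo_subset_Ioc_self

/-- Integration by parts: `φ z - ∫ (φ' z + φ g)` is absolutely continuous with zero derivative a.e.,
hence constant, and `φ` vanishes at both endpoints. -/
theorem isWeakDeriv [CompleteSpace E] (hT : 0 ≤ T) (h : IsPrimitiveOn T z g) :
    IsWeakDeriv T z g := by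
  intro φ hφ hc hs
  have hφ1 : ContDiff ℝ 1 φ := hφ.of_le (by exact_mod_cast le_top)
  have hφd : Continuous (deriv φ) := hφ1.continuous_deriv le_rfl
  have hz := h.continuousOn hT
  have hi1 : IntervalIntegrable (fun t => deriv φ t • z t) volume 0 T :=
    ContinuousOn.intervalIntegrable (by
      rw [uIcc_of_le hT]; exact hφd.continuousOn.smul hz)
  have hi2 : IntervalIntegrable (fun t => φ t • g t) volume 0 T :=
    h.intervalIntegrable.continuousOn_smul hφ1.continuous.continuousOn
  have hi := hi1.add hi2
  have hprim : IsPrimitiveOn T (fun t => ∫ s in 0..t, (deriv φ s • z s + φ s • g s))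
      (fun t => deriv φ t • z t + φ t • g t) := ⟨hi, fun t _ => by simp⟩
  have hac : AbsolutelyContinuousOnInterval
      ((fun t => φ t • z t) - fun t => ∫ s in 0..t, (deriv φ s • z s + φ s • g s)) 0 T :=
    ((hφ1.contDiffOn.absolutelyContinuousOnInterval).smul
      (h.absolutelyContinuousOnInterval hT)).sub (hprim.absolutelyContinuousOnInterval hT)
  have h0 : φ 0 = 0 := by
    by_contra hne
    exact lt_irrefl _ (hs (subset_tsupport φ hne)).1
  have hT0 : φ T = 0 := by
    by_contra hne
    exact lt_irrefl _ (hs (subset_tsupport φ hne)).2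
  obtain ⟨C, hC⟩ := hac.const_of_ae_hasDerivAt_zero (by
    have hne0 : ∀ᵐ x : ℝ, x ≠ 0 := by simp [ae_iff, measure_singleton]
    have hneT : ∀ᵐ x : ℝ, x ≠ T := by simp [ae_iff, measure_singleton]
    filter_upwards [h.ae_hasDerivAt, hprim.ae_hasDerivAt, hne0, hneT] with t h1 h2 h3 h4 ht
    rw [uIcc_of_le hT] at ht
    have ht' : t ∈ Ioo 0 T := ⟨lt_of_le_of_ne ht.1 h3.symm, lt_of_le_of_ne ht.2 h4⟩
    have hφt : HasDerivAt φ (deriv φ t) t := (hφ1.differentiable one_ne_zero t).hasDerivAt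
    convert! (hφt.smul (h1 ht')).sub (h2 ht') using 1
    abel)
  have e0 := hC 0 (by simp)
  have eT := hC T (by simp)
  simp only [Pi.sub_apply, h0, hT0, zero_smul, intervalIntegral.integral_same, sub_zero,
    zero_sub] at e0 eT
  rw [← e0, neg_eq_zero, intervalIntegral.integral_add hi1 hi2] at eT
  simp only [intervalIntegral.integral_of_le hT, integral_Ioc_eq_integral_Ioo] at eT
  exact eq_neg_of_add_eq_zero_left eT

end IsPrimitiveOn

/-- The du Bois-Reymond lemma: a continuous function with vanishing weak derivative is constant. -/
theorem IsWeakDeriv.const_of_zero [CompleteSpace E] {T : ℝ} {u : ℝ → E}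
    (hu : ContinuousOn u (Icc 0 T))
    (h : ∀ φ : ℝ → ℝ, ContDiff ℝ ((⊤ : ℕ∞) : WithTop ℕ∞) φ → HasCompactSupport φ →
      tsupport φ ⊆ Ioo 0 T → ∫ t in Ioo 0 T, deriv φ t • u t = 0) :
    ∀ t ∈ Icc 0 T, u t = u 0 := by
  intro t₀ ht₀
  rcases (ht₀.1.trans ht₀.2).eq_or_lt with hT | hT
  · rw [le_antisymm (hT ▸ ht₀.2) ht₀.1]
  let b : ContDiffBump (T / 2) := ⟨T / 8, T / 4, by positivity, by linarith⟩
  set ρ : ℝ → ℝ := b.normed volume with hρdef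
  have hρ : ContDiff ℝ ((⊤ : ℕ∞) : WithTop ℕ∞) ρ := b.contDiff_normed
  have hρc : HasCompactSupport ρ := b.hasCompactSupport_normed
  have hρs : tsupport ρ ⊆ Ioo 0 T := by
    rw [hρdef, b.tsupport_normed_eq, Real.closedBall_eq_Icc]
    intro x hx
    have h1 : T / 2 - T / 4 ≤ x := hx.1
    have h2 : x ≤ T / 2 + T / 4 := hx.2
    exact ⟨by linarith, by linarith⟩
  have hρ1 : ∫ x, ρ x = 1 := b.integral_normed
  have hInt : ∀ ψ : ℝ → ℝ, Continuous ψ →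
      Integrable (fun t => ψ t • u t) (volume.restrict (Ioo 0 T)) := fun ψ hψ =>
    ((hψ.continuousOn.smul hu).integrableOn_compact isCompact_Icc).mono_set Ioo_subset_Icc_self
  set c : E := ∫ t in Ioo 0 T, ρ t • u t with hc
  have hae : ∀ᵐ t, t ∈ Ioo 0 T → u t - c = 0 := by
    refine isOpen_Ioo.ae_eq_zero_of_integral_contDiff_smul_eq_zero
      (((hu.mono Ioo_subset_Icc_self).sub continuousOn_const).locallyIntegrableOn
        measurableSet_Ioo) fun ψ hψ hψc hψs => ?_
    -- Subtracting a multiple of the unit-mass bump `ρ` gives mean zero, so the primitive of `θ` is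
    -- itself a test function; its derivative tests `u` and leaves `∫ ψ (u - c) = 0`.
    set θ : ℝ → ℝ := fun x => ψ x - (∫ y, ψ y) * ρ x with hθdef
    have hθ : ContDiff ℝ ((⊤ : ℕ∞) : WithTop ℕ∞) θ := hψ.sub (contDiff_const.mul hρ)
    have hθ0 : ∫ x, θ x = 0 := by
      rw [hθdef, integral_sub (hψ.continuous.integrable_of_hasCompactSupport hψc)
        ((hρ.continuous.integrable_of_hasCompactSupport hρc).const_mul _),
        integral_const_mul, hρ1, mul_one, sub_self]
    -- The point `T / 2` only makes nonemptiness evident, so that `K` has a least and a greatest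
    -- element.
    set K : Set ℝ := tsupport ψ ∪ tsupport ρ ∪ {T / 2} with hK
    have hKc : IsCompact K := (hψc.isCompact.union hρc.isCompact).union isCompact_singleton
    have hKne : K.Nonempty := ⟨T / 2, by simp [hK]⟩
    have hKs : K ⊆ Ioo 0 T := by
      refine union_subset (union_subset hψs hρs) ?_
      rw [singleton_subset_iff]
      exact ⟨by linarith, by linarith⟩
    have hθK : ∀ x, x ∉ K → θ x = 0 := by
      intro x hx
      have h1 : ψ x = 0 := by
        by_contra hne
        exact hx (Or.inl (Or.inl (subset_tsupport ψ hne)))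
      have h2 : ρ x = 0 := by
        by_contra hne
        exact hx (Or.inl (Or.inr (subset_tsupport ρ hne)))
      simp [hθdef, h1, h2]
    obtain ⟨p, hpK, hp⟩ := hKc.exists_isLeast hKne
    obtain ⟨q, hqK, hq⟩ := hKc.exists_isGreatest hKne
    set φ : ℝ → ℝ := fun x => ∫ y in 0..x, θ y with hφdef
    have hφd : ∀ x, HasDerivAt φ (θ x) x := fun x =>
      hθ.continuous.integral_hasStrictDerivAt 0 x |>.hasDerivAt
    have hφderiv : deriv φ = θ := funext fun x => (hφd x).deriv
    have hφ : ContDiff ℝ ((⊤ : ℕ∞) : WithTop ℕ∞) φ :=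
      contDiff_infty_iff_deriv.2 ⟨fun x => (hφd x).differentiableAt, hφderiv ▸ hθ⟩
    have hφ0 : ∀ x, x ∉ Icc p q → φ x = 0 := by
      intro x hx
      rw [mem_Icc, not_and_or, not_le, not_le] at hx
      -- Left of `p` nothing has been integrated yet; right of `q` all of the zero mass has.
      rcases hx with hx | hx
      · refine intervalIntegral.integral_zero_ae (Eventually.of_forall fun y hy => hθK y fun hyK => ?_)
        have h1 := hp hyK
        have h2 : y ≤ max 0 x := hy.2
        have h3 := (hKs hpK).1
        rcases max_cases 0 x with ⟨h4, _⟩ | ⟨h4, _⟩ <;> linarith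
      · refine Eq.trans ?_ hθ0
        refine intervalIntegral.integral_eq_integral_of_support_subset fun y hy => ?_
        have hyK : y ∈ K := by
          by_contra hne
          exact hy (hθK y hne)
        exact ⟨(hKs hyK).1, (hq hyK).trans hx.le⟩
    have hφs : tsupport φ ⊆ Icc p q := closure_minimal (fun x hx => by
      by_contra hne
      exact hx (hφ0 x hne)) isClosed_Icc
    have hφc : HasCompactSupport φ := HasCompactSupport.of_support_subset_isCompact isCompact_Icc
      ((subset_tsupport φ).trans hφs)
    have key := h φ hφ hφc (hφs.trans fun x hx =>
      ⟨(hKs hpK).1.trans_le hx.1, hx.2.trans_lt (hKs hqK).2⟩)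
    rw [hφderiv] at key
    have hψ0 : ∀ x, x ∉ Ioo 0 T → ψ x = 0 := fun x hx => by
      by_contra hne
      exact hx (hψs (subset_tsupport ψ hne))
    have e1 : ∫ x, ψ x • (u x - c) = ∫ x in Ioo 0 T, ψ x • (u x - c) :=
      (setIntegral_eq_integral_of_forall_compl_eq_zero fun x hx => by simp [hψ0 x hx]).symm
    have e2 : ∫ x in Ioo 0 T, ψ x = ∫ x, ψ x :=
      setIntegral_eq_integral_of_forall_compl_eq_zero hψ0
    have e3 : ∫ x in Ioo 0 T, θ x • u x
        = (∫ x in Ioo 0 T, ψ x • u x) - (∫ y, ψ y) • c := by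
      rw [hc, ← integral_smul]
      refine Eq.trans ?_ (integral_sub (hInt ψ hψ.continuous)
        ((hInt ρ hρ.continuous).smul (∫ y, ψ y)))
      refine integral_congr_ae (Eventually.of_forall fun x => ?_)
      simp [hθdef, sub_smul, mul_smul]
    have hψi : Integrable ψ (volume.restrict (Ioo 0 T)) :=
      (hψ.continuous.integrable_of_hasCompactSupport hψc).restrict
    rw [e1]
    simp_rw [smul_sub]
    rw [integral_sub (hInt ψ hψ.continuous) (hψi.smul_const c), integral_smul_const, e2, ← e3, key]
  have hEq : EqOn u (fun _ => c) (Icc 0 T) := by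
    refine Measure.eqOn_Icc_of_ae_eq volume hT.ne ?_ hu continuousOn_const
    rw [EventuallyEq, ← Measure.restrict_congr_set Ioo_ae_eq_Icc,
      ae_restrict_iff' measurableSet_Ioo]
    filter_upwards [hae] with t ht htm
    exact sub_eq_zero.1 (ht htm)
  rw [hEq ht₀, hEq ⟨le_rfl, hT.le⟩]

/-- The du Bois-Reymond lemma applies to `z - ∫ g`. Continuity of `z` turns the a.e. identity into
one at every point, which makes differentiation a.e. and Gronwall available for arbitrary `W^{1,1}`
solutions. -/
theorem IsSobolevWithDeriv.isPrimitiveOn [CompleteSpace E] {T : ℝ} (hT : 0 ≤ T) {z g : ℝ → E}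
    (h : IsSobolevWithDeriv 1 T z g) (hz : ContinuousOn z (Icc 0 T)) : IsPrimitiveOn T z g := by
  have hg : Integrable g (volume.restrict (Ioo 0 T)) := memLp_one_iff_integrable.1 h.memLp_deriv
  have hgi : IntervalIntegrable g volume 0 T := by
    rw [intervalIntegrable_iff_integrableOn_Ioc_of_le hT, IntegrableOn,
      Measure.restrict_congr_set Ioo_ae_eq_Ioc.symm]
    exact hg
  have hG : IsPrimitiveOn T (fun t => ∫ s in 0..t, g s) g := ⟨hgi, fun t _ => by simp⟩
  have hGc := hG.continuousOn hT
  refine ⟨hgi, fun t ht => ?_⟩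
  have hInt : ∀ ψ : ℝ → ℝ, Continuous ψ → ∀ u : ℝ → E, ContinuousOn u (Icc 0 T) →
      Integrable (fun t => ψ t • u t) (volume.restrict (Ioo 0 T)) := fun ψ hψ u hu =>
    ((hψ.continuousOn.smul hu).integrableOn_compact isCompact_Icc).mono_set Ioo_subset_Icc_self
  have := IsWeakDeriv.const_of_zero (T := T) (u := fun t => z t - ∫ s in 0..t, g s)
    (hz.sub hGc) (fun φ hφ hc hs => by
      have hφ1 : ContDiff ℝ 1 φ := hφ.of_le (by exact_mod_cast le_top)
      have hφd : Continuous (deriv φ) := hφ1.continuous_deriv le_rfl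
      simp_rw [smul_sub]
      rw [integral_sub (hInt _ hφd _ hz) (hInt _ hφd _ hGc), h.isWeakDeriv φ hφ hc hs,
        hG.isWeakDeriv hT φ hφ hc hs, sub_self]) t ht
  simp only [intervalIntegral.integral_same, sub_zero] at this
  rw [← this]
  abel

end Primitive

/-! ### Elliptic operators and the stability estimate. -/

section Operator

variable {Z : Type*} [NormedAddCommGroup Z] [InnerProductSpace ℝ Z]

/-- A symmetric bilinear form is bounded by its quadratic form. -/
theorem opNorm_le_of_abs_quadratic_le {Q : Z →L[ℝ] StrongDual ℝ Z} {c : ℝ} (hc : 0 ≤ c)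
    (hsymm : ∀ u v, Q u v = Q v u) (h : ∀ v, |Q v v| ≤ c * ‖v‖ ^ 2) : ‖Q‖ ≤ c := by
  have h1 : ∀ u v, ‖u‖ = 1 → ‖v‖ = 1 → |Q u v| ≤ c := by
    intro u v hu hv
    -- Polarisation; the parallelogram law then gives `‖u + v‖² + ‖u - v‖² = 4` for unit vectors.
    have e : Q u v = (Q (u + v) (u + v) - Q (u - v) (u - v)) / 4 := by
      simp only [map_add, map_sub, add_apply, sub_apply,
        hsymm v u]
      ring
    have hp := parallelogram_law_with_norm ℝ u v
    have h2 := abs_le.1 (h (u + v))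
    have h3 := abs_le.1 (h (u - v))
    rw [hu, hv] at hp
    have hs : ‖u + v‖ ^ 2 + ‖u - v‖ ^ 2 = 4 := by nlinarith
    have hs' : c * ‖u + v‖ ^ 2 + c * ‖u - v‖ ^ 2 = 4 * c := by rw [← mul_add, hs]; ring
    rw [e, abs_le]
    constructor <;> linarith
  have h2 : ∀ u v, |Q u v| ≤ c * ‖u‖ * ‖v‖ := by
    intro u v
    rcases eq_or_ne u 0 with rfl | hu
    · simp
    rcases eq_or_ne v 0 with rfl | hv
    · simp
    have hu' := norm_pos_iff.2 hu
    have hv' := norm_pos_iff.2 hv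
    have := h1 (‖u‖⁻¹ • u) (‖v‖⁻¹ • v) (by rw [norm_smul, norm_inv, norm_norm, inv_mul_cancel₀ hu'.ne'])
      (by rw [norm_smul, norm_inv, norm_norm, inv_mul_cancel₀ hv'.ne'])
    simp only [map_smul, smul_apply, smul_eq_mul, abs_mul, abs_inv,
      abs_norm] at this
    calc |Q u v| = ‖v‖ * ‖u‖ * (‖v‖⁻¹ * (‖u‖⁻¹ * |Q u v|)) := by field_simp
      _ ≤ ‖v‖ * ‖u‖ * c := by gcongr
      _ = c * ‖u‖ * ‖v‖ := by ring
  refine Q.opNorm_le_bound hc fun u => ?_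
  exact (Q u).opNorm_le_bound (by positivity) fun v => h2 u v

/-- A continuously differentiable map `B : Z → Z*` whose derivative `H` is symmetric, uniformly
elliptic with constant `κ`, and locally Lipschitz as a field of quadratic forms. -/
structure IsEllipticOperator (B : Z → StrongDual ℝ Z) (H : Z → Z →L[ℝ] StrongDual ℝ Z)
    (κ : ℝ) : Prop where
  hasFDerivAt : ∀ z, HasFDerivAt B (H z) z
  symm : ∀ z u v, H z u v = H z v u
  pos : 0 < κ
  elliptic : ∀ z v, κ * ‖v‖ ^ 2 ≤ H z v v
  locLipschitz : ∀ r : ℝ, 0 < r → ∃ C : ℝ, 0 ≤ C ∧ ∀ z₁ ∈ Metric.ball (0 : Z) r,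
    ∀ z₂ ∈ Metric.ball (0 : Z) r, ∀ v : Z, (H z₁ - H z₂) v v ≤ C * ‖z₁ - z₂‖ * ‖v‖ ^ 2

namespace IsEllipticOperator

variable {B : Z → StrongDual ℝ Z} {H : Z → Z →L[ℝ] StrongDual ℝ Z} {κ : ℝ}

theorem strongly_monotone (h : IsEllipticOperator B H κ) (x y : Z) :
    κ * ‖x - y‖ ^ 2 ≤ (B x - B y) (x - y) := by
  set φ : ℝ → ℝ := fun s => B (y + s • (x - y)) (x - y) with hφ
  have hd : ∀ s, HasDerivAt φ (H (y + s • (x - y)) (x - y) (x - y)) s := by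
    intro s
    have h1 : HasDerivAt (fun s : ℝ => y + s • (x - y)) (x - y) s := by
      simpa using ((hasDerivAt_id s).smul_const (x - y)).const_add y
    have h2 := (h.hasFDerivAt (y + s • (x - y))).comp_hasDerivAt s h1
    exact (h2.clm_apply (hasDerivAt_const s (x - y))).congr_deriv (by simp)
  obtain ⟨s, -, hs⟩ := exists_hasDerivAt_eq_slope φ _ zero_lt_one
    (fun s _ => (hd s).continuousAt.continuousWithinAt) (fun s _ => hd s)
  have := h.elliptic (y + s • (x - y)) (x - y)
  rw [hs] at this
  simpa [hφ] using this

/-- The one-sided bound on quadratic forms becomes two-sided on swapping the points, and symmetry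
upgrades it to the operator norm. -/
theorem exists_norm_sub_le (h : IsEllipticOperator B H κ) {r : ℝ} (hr : 0 < r) : ∃ C : ℝ, 0 ≤ C ∧
    ∀ x ∈ Metric.ball (0 : Z) r, ∀ y ∈ Metric.ball (0 : Z) r, ‖H x - H y‖ ≤ C * ‖x - y‖ := by
  obtain ⟨C, hC, hb⟩ := h.locLipschitz r hr
  refine ⟨C, hC, fun x hx y hy => opNorm_le_of_abs_quadratic_le (by positivity) (fun u v => ?_)
    fun v => abs_le'.2 ⟨hb x hx y hy v, ?_⟩⟩
  · simp [h.symm x u v, h.symm y u v]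
  · have := hb y hy x hx v
    rw [norm_sub_rev y x] at this
    simpa using this

/-- On balls, `B` is Lipschitz and has a second order Taylor estimate. -/
theorem exists_taylor (h : IsEllipticOperator B H κ) {r : ℝ} (hr : 0 < r) : ∃ C : ℝ, 0 ≤ C ∧
    ∀ x ∈ Metric.ball (0 : Z) r, ∀ y ∈ Metric.ball (0 : Z) r,
      ‖B x - B y‖ ≤ C * ‖x - y‖ ∧ ‖B x - B y - H x (x - y)‖ ≤ C * ‖x - y‖ ^ 2 := by
  obtain ⟨C, hC, hb⟩ := h.exists_norm_sub_le hr
  have h0 : (0 : Z) ∈ Metric.ball (0 : Z) r := Metric.mem_ball_self hr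
  -- One constant serves both estimates: `C` controls the Taylor remainder, `‖H 0‖ + C r` bounds `H`
  -- on the ball.
  refine ⟨C + (‖H 0‖ + C * r), by positivity, fun x hx y hy => ⟨?_, ?_⟩⟩
  · have hH : ∀ z ∈ Metric.ball (0 : Z) r, ‖H z‖ ≤ ‖H 0‖ + C * r := fun z hz => by
      have h1 := hb z hz 0 h0
      rw [sub_zero] at h1
      have h2 : ‖z‖ ≤ r := (mem_ball_zero_iff.1 hz).le
      have h3 : ‖H z‖ ≤ ‖H 0‖ + ‖H z - H 0‖ := by
        have e : H z = H 0 + (H z - H 0) := by ext; simp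
        calc ‖H z‖ = ‖H 0 + (H z - H 0)‖ := by rw [← e]
          _ ≤ _ := ContinuousLinearMap.opNorm_add_le _ _
      nlinarith
    have := (convex_ball (0 : Z) r).norm_image_sub_le_of_norm_hasFDerivWithin_le
      (fun z _ => (h.hasFDerivAt z).hasFDerivWithinAt) hH hy hx
    nlinarith [norm_nonneg (x - y)]
  · have hseg : ∀ z ∈ segment ℝ x y, ‖H z - H x‖ ≤ C * ‖x - y‖ := fun z hz => by
      refine (hb z ((convex_ball (0 : Z) r).segment_subset hx hy hz) x hx).trans ?_
      gcongr
      obtain ⟨a, b, ha, hb', hab, rfl⟩ := hz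
      have : a • x + b • y - x = -(b • (x - y)) := by
        rw [← eq_sub_iff_add_eq] at hab
        rw [hab, sub_smul, one_smul, smul_sub]
        abel
      rw [this, norm_neg, norm_smul, Real.norm_of_nonneg hb']
      nlinarith [norm_nonneg (x - y)]
    have := (convex_segment x y).norm_image_sub_le_of_norm_hasFDerivWithin_le'
      (fun z _ => (h.hasFDerivAt z).hasFDerivWithinAt) hseg (right_mem_segment ℝ x y)
      (left_mem_segment ℝ x y)
    refine this.trans ?_
    rw [mul_assoc, ← sq]
    gcongr
    nlinarith [norm_nonneg (H 0)]

/-- The Mielke–Theil stability estimate for two absolutely continuous curves with the same initial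
value. -/
theorem stability [CompleteSpace Z] (h : IsEllipticOperator B H κ) {r : ℝ} (hr : 0 < r) :
    ∃ C : ℝ, 0 ≤ C ∧ ∀ (T ε : ℝ) (z₁ z₂ g₁ g₂ : ℝ → Z), 0 ≤ T → 0 ≤ ε →
      IsPrimitiveOn T z₁ g₁ → IsPrimitiveOn T z₂ g₂ → z₁ 0 = z₂ 0 →
      (∀ t ∈ Icc 0 T, z₁ t ∈ Metric.ball (0 : Z) r) →
      (∀ t ∈ Icc 0 T, z₂ t ∈ Metric.ball (0 : Z) r) →
      (∀ᵐ t, t ∈ Ioo 0 T → (B (z₁ t) - B (z₂ t)) (g₁ t - g₂ t) ≤ ε) →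
      κ * ‖z₁ T - z₂ T‖ ^ 2 ≤
        2 * ε * T * Real.exp (∫ s in 0..T, C * (‖g₁ s‖ + ‖g₂ s‖)) := by
  obtain ⟨C, hC, hb⟩ := h.exists_taylor hr
  refine ⟨C / κ, div_nonneg hC h.pos.le, ?_⟩
  intro T ε z₁ z₂ g₁ g₂ hT hε h₁ h₂ h0 hz₁ hz₂ hmono
  refine (h.strongly_monotone _ _).trans ?_
  have hN : IntervalIntegrable (fun s => ‖g₁ s‖ + ‖g₂ s‖) volume 0 T :=
    h₁.intervalIntegrable.norm.add h₂.intervalIntegrable.norm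
  have hNp : IsPrimitiveOn T (fun t => ∫ s in 0..t, (‖g₁ s‖ + ‖g₂ s‖))
    (fun s => ‖g₁ s‖ + ‖g₂ s‖) := ⟨hN, fun t _ => by simp⟩
  have hm := hN.const_mul (C / κ)
  refine AbsolutelyContinuousOnInterval.gronwall
    (γ := fun t => (B (z₁ t) - B (z₂ t)) (z₁ t - z₂ t)) hT (by positivity) ?_ hm
    (fun t => mul_nonneg (div_nonneg hC h.pos.le) (by positivity)) (by simp [h0]) ?_
  -- Absolute continuity of `γ`: on the ball `B` is Lipschitz, and the product rule for increments
  -- costs `2C·2r + 2Cr·2 = 8Cr` times the increment of `∫ (‖g₁‖ + ‖g₂‖)`.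
  · refine (hNp.absolutelyContinuousOnInterval hT).of_dist_le (C := 8 * (C * r))
      fun s hs t ht => ?_
    rw [uIcc_of_le hT] at hs ht
    have hd₁ : ‖z₁ s - z₁ t‖ ≤ |∫ x in t..s, (‖g₁ x‖ + ‖g₂ x‖)| := by
      rw [h₁.sub_eq_integral ht hs]
      exact intervalIntegral.norm_integral_le_abs_of_norm_le
        (Eventually.of_forall fun x => by simp) (hNp.intervalIntegrable_of_mem ht hs)
    have hd₂ : ‖z₂ s - z₂ t‖ ≤ |∫ x in t..s, (‖g₁ x‖ + ‖g₂ x‖)| := by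
      rw [h₂.sub_eq_integral ht hs]
      exact intervalIntegral.norm_integral_le_abs_of_norm_le
        (Eventually.of_forall fun x => by simp) (hNp.intervalIntegrable_of_mem ht hs)
    rw [Real.dist_eq, Real.dist_eq, hNp.sub_eq_integral ht hs]
    set D := |∫ x in t..s, (‖g₁ x‖ + ‖g₂ x‖)| with hD
    have hD0 : 0 ≤ D := abs_nonneg _
    have hball : ∀ x ∈ Metric.ball (0 : Z) r, ∀ y ∈ Metric.ball (0 : Z) r, ‖x - y‖ ≤ 2 * r :=
      fun x hx y hy => by
        linarith [norm_sub_le x y, mem_ball_zero_iff.1 hx, mem_ball_zero_iff.1 hy]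
    have e : (B (z₁ s) - B (z₂ s)) (z₁ s - z₂ s) - (B (z₁ t) - B (z₂ t)) (z₁ t - z₂ t)
        = ((B (z₁ s) - B (z₁ t)) - (B (z₂ s) - B (z₂ t))) (z₁ s - z₂ s)
          + (B (z₁ t) - B (z₂ t)) ((z₁ s - z₁ t) - (z₂ s - z₂ t)) := by
      simp only [sub_apply, map_sub]
      ring
    rw [e]
    have n1 : ‖(B (z₁ s) - B (z₁ t)) - (B (z₂ s) - B (z₂ t))‖ ≤ C * D + C * D := by
      refine (norm_sub_le _ _).trans (add_le_add ?_ ?_)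
      · exact (hb _ (hz₁ s hs) _ (hz₁ t ht)).1.trans (by gcongr)
      · exact (hb _ (hz₂ s hs) _ (hz₂ t ht)).1.trans (by gcongr)
    have n2 : ‖B (z₁ t) - B (z₂ t)‖ ≤ C * (2 * r) :=
      (hb _ (hz₁ t ht) _ (hz₂ t ht)).1.trans (by gcongr; exact hball _ (hz₁ t ht) _ (hz₂ t ht))
    have n3 : ‖(z₁ s - z₁ t) - (z₂ s - z₂ t)‖ ≤ D + D :=
      (norm_sub_le _ _).trans (add_le_add hd₁ hd₂)
    calc _ ≤ (C * D + C * D) * (2 * r) + C * (2 * r) * (D + D) := by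
          refine (abs_add_le _ _).trans (add_le_add ?_ ?_)
          · exact (ContinuousLinearMap.le_of_opNorm_le _ n1 _).trans
              (by gcongr; exact hball _ (hz₁ s hs) _ (hz₂ s hs))
          · exact (ContinuousLinearMap.le_of_opNorm_le _ n2 _).trans (by gcongr)
      _ = 8 * (C * r) * D := by ring
  -- By symmetry `H(zᵢ) gᵢ` tested with `d = z₁ - z₂` equals `H(zᵢ) d` tested with `gᵢ`, that is `(B
  -- z₁ - B z₂) gᵢ` up to `C‖d‖²‖gᵢ‖`. Both halves of the product rule thus produce `(B z₁ - B
  -- z₂)(g₁ - g₂) ≤ ε`, whence `2ε`.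
  · filter_upwards [h₁.ae_hasDerivAt, h₂.ae_hasDerivAt, hmono] with t hd₁ hd₂ hmt ht
    have hB₁ := (h.hasFDerivAt (z₁ t)).comp_hasDerivAt t (hd₁ ht)
    have hB₂ := (h.hasFDerivAt (z₂ t)).comp_hasDerivAt t (hd₂ ht)
    refine ⟨_, (hB₁.sub hB₂).clm_apply ((hd₁ ht).sub (hd₂ ht)), ?_⟩
    have ht' := Ioo_subset_Icc_self ht
    have hm := hmt ht
    have hsm := h.strongly_monotone (z₁ t) (z₂ t)
    have t1 := (hb _ (hz₁ t ht') _ (hz₂ t ht')).2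
    have t2 := (hb _ (hz₂ t ht') _ (hz₁ t ht')).2
    have a1 := (abs_le.1 ((B (z₁ t) - B (z₂ t) - H (z₁ t) (z₁ t - z₂ t)).le_of_opNorm_le t1
      (g₁ t))).1
    have a2 := (abs_le.1 ((B (z₂ t) - B (z₁ t) - H (z₂ t) (z₂ t - z₁ t)).le_of_opNorm_le t2
      (g₂ t))).1
    rw [norm_sub_rev (z₂ t)] at a2
    have s1 := h.symm (z₁ t) (g₁ t) (z₁ t - z₂ t)
    have s2 := h.symm (z₂ t) (g₂ t) (z₁ t - z₂ t)
    have hκ : ‖z₁ t - z₂ t‖ ^ 2 ≤ (B (z₁ t) - B (z₂ t)) (z₁ t - z₂ t) / κ := by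
      rw [le_div_iff₀ h.pos, mul_comm]
      exact hsm
    have hfin : C * ‖z₁ t - z₂ t‖ ^ 2 * (‖g₁ t‖ + ‖g₂ t‖) ≤
        C / κ * (‖g₁ t‖ + ‖g₂ t‖) * (B (z₁ t) - B (z₂ t)) (z₁ t - z₂ t) := by
      calc _ ≤ C * ((B (z₁ t) - B (z₂ t)) (z₁ t - z₂ t) / κ) * (‖g₁ t‖ + ‖g₂ t‖) := by gcongr
        _ = _ := by ring
    simp only [Pi.sub_apply, Function.comp_apply, sub_apply, map_sub] at *
    linarith

end IsEllipticOperator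

end Operator

/-! ### Sublinear functionals, their subdifferentials and Hahn–Banach. -/

section Dissipation

variable {E : Type*} [NormedAddCommGroup E] [NormedSpace ℝ E]

/-- Nonnegative, finite, bounded sublinear functionals. -/
structure IsSublinearPotential (Ψ : E → ℝ) : Prop where
  nonneg : ∀ v, 0 ≤ Ψ v
  add_le : ∀ u v, Ψ (u + v) ≤ Ψ u + Ψ v
  smul : ∀ c : ℝ, 0 < c → ∀ v, Ψ (c • v) = c * Ψ v
  bounded : ∃ ρ : ℝ, 0 < ρ ∧ ∀ v, Ψ v ≤ ρ * ‖v‖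

namespace IsSublinearPotential

variable {Ψ : E → ℝ}

theorem map_zero (h : IsSublinearPotential Ψ) : Ψ 0 = 0 := by
  have := h.smul 2 (by norm_num) 0
  rw [smul_zero] at this
  linarith

theorem comp (h : IsSublinearPotential Ψ) {G : Type*} [NormedAddCommGroup G] [NormedSpace ℝ G]
    (ι : G →L[ℝ] E) : IsSublinearPotential (fun v => Ψ (ι v)) := by
  obtain ⟨ρ, hρ, hb⟩ := h.bounded
  refine ⟨fun v => h.nonneg _, fun u v => by rw [map_add]; exact h.add_le _ _,
    fun c hc v => by rw [map_smul]; exact h.smul c hc _, ρ * (‖ι‖ + 1), by positivity, fun v => ?_⟩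
  calc Ψ (ι v) ≤ ρ * ‖ι v‖ := hb _
    _ ≤ ρ * ((‖ι‖ + 1) * ‖v‖) := by
        gcongr
        nlinarith [ι.le_opNorm v, norm_nonneg v]
    _ = ρ * (‖ι‖ + 1) * ‖v‖ := by ring

theorem continuous (h : IsSublinearPotential Ψ) : Continuous Ψ := by
  obtain ⟨ρ, hρ, hb⟩ := h.bounded
  have h1 : ∀ u v, Ψ u - Ψ v ≤ ρ * ‖u - v‖ := fun u v => by
    have := h.add_le (u - v) v
    rw [sub_add_cancel] at this
    linarith [hb (u - v)]
  refine (LipschitzWith.of_dist_le_mul (K := ⟨ρ, hρ.le⟩) fun u v => ?_).continuous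
  rw [Real.dist_eq, dist_eq_norm]
  exact abs_sub_le_iff.2 ⟨h1 u v, by rw [norm_sub_rev]; exact h1 v u⟩

/-- Test with `0`, `2w` and `w + v`. The inclusion splits into a stability condition independent of
`w` and an energy balance, which are handled separately in the limit. -/
theorem mem_subdifferential_iff (h : IsSublinearPotential Ψ) {ξ : StrongDual ℝ E} {w : E} :
    ξ ∈ subdifferential Ψ w ↔ (∀ v, ξ v ≤ Ψ v) ∧ Ψ w ≤ ξ w := by
  constructor
  · intro hξ
    have h0 := hξ 0
    have h2 := hξ ((2 : ℝ) • w)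
    rw [h.smul 2 (by norm_num), two_smul, add_sub_cancel_right] at h2
    rw [h.map_zero, zero_sub, map_neg] at h0
    refine ⟨fun v => ?_, by linarith⟩
    have h3 := hξ (w + v)
    rw [add_sub_cancel_left] at h3
    linarith [h.add_le w v]
  · rintro ⟨h1, h2⟩ v
    rw [map_sub]
    linarith [h1 v]

/-- Hahn–Banach for sublinear majorants; the bound `Ψ ≤ ρ‖·‖` makes the extension continuous. -/
theorem exists_extension (h : IsSublinearPotential Ψ) (f : E →ₗ.[ℝ] ℝ)
    (hf : ∀ x : f.domain, f x ≤ Ψ x) :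
    ∃ ζ : StrongDual ℝ E, (∀ x : f.domain, ζ x = f x) ∧ ∀ v, ζ v ≤ Ψ v := by
  obtain ⟨g, hg1, hg2⟩ := exists_extension_of_le_sublinear f Ψ h.smul h.add_le hf
  obtain ⟨ρ, hρ, hb⟩ := h.bounded
  refine ⟨g.mkContinuous ρ fun x => ?_, hg1, hg2⟩
  rw [Real.norm_eq_abs, abs_le']
  refine ⟨(hg2 x).trans (hb x), ?_⟩
  rw [← map_neg, ← norm_neg]
  exact (hg2 _).trans (hb _)

/-- Extend `c w ↦ c Ψ(w)` from the line through `w`; negative `c` is harmless because `Ψ ≥ 0`. -/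
theorem exists_support (h : IsSublinearPotential Ψ) (w : E) :
    ∃ ζ : StrongDual ℝ E, (∀ v, ζ v ≤ Ψ v) ∧ ζ w = Ψ w := by
  rcases eq_or_ne w 0 with rfl | hw
  · exact ⟨0, fun v => by simpa using h.nonneg v, by simp [h.map_zero]⟩
  obtain ⟨ζ, h1, h2⟩ := h.exists_extension (LinearPMap.mkSpanSingleton w (Ψ w) hw) (by
    rintro ⟨x, hx⟩
    obtain ⟨c, rfl⟩ := Submodule.mem_span_singleton.1 hx
    have e1 : LinearPMap.mkSpanSingleton w (Ψ w) hw ⟨c • w, hx⟩ = c • Ψ w :=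
      LinearPMap.mkSpanSingleton'_apply ..
    rw [e1]
    rcases lt_trichotomy c 0 with hc | rfl | hc
    · have : 0 ≤ Ψ (c • w) := h.nonneg _
      have h3 := mul_nonneg_of_nonpos_of_nonpos hc.le (neg_nonpos.2 (h.nonneg w))
      simp only [smul_eq_mul]
      linarith
    · simpa using h.nonneg _
    · simp [h.smul c hc])
  refine ⟨ζ, h2, ?_⟩
  have := h1 ⟨w, Submodule.mem_span_singleton_self w⟩
  rw [this]
  exact LinearPMap.mkSpanSingleton_apply ..

/-- Injectivity carries `ξ` to the range of `ι`, where it is dominated by `Ψ` and so extends. This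
is what identifies `∂(Ψ ∘ ι)` with restrictions of `∂Ψ`. -/
theorem exists_comp_eq (h : IsSublinearPotential Ψ) {G : Type*} [NormedAddCommGroup G]
    [NormedSpace ℝ G] {ι : G →L[ℝ] E} (hι : Function.Injective ι) {ξ : StrongDual ℝ G}
    (hξ : ∀ v, ξ v ≤ Ψ (ι v)) : ∃ η : StrongDual ℝ E, (∀ v, η v ≤ Ψ v) ∧ η.comp ι = ξ := by
  let e : G ≃ₗ[ℝ] LinearMap.range (ι : G →ₗ[ℝ] E) :=
    LinearEquiv.ofInjective (ι : G →ₗ[ℝ] E) hι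
  obtain ⟨η, h1, h2⟩ := h.exists_extension
    ⟨LinearMap.range (ι : G →ₗ[ℝ] E), (ξ : G →ₗ[ℝ] ℝ) ∘ₗ e.symm.toLinearMap⟩ (by
      rintro x
      obtain ⟨v, rfl⟩ := e.surjective x
      simpa [e] using hξ v)
  refine ⟨η, h2, ?_⟩
  ext v
  have := h1 (e v)
  simpa [e] using this

end IsSublinearPotential

theorem IsAdmissibleDissipation.isSublinearPotential {V X : Type*} [NormedAddCommGroup V]
    [InnerProductSpace ℝ V] [NormedAddCommGroup X] [NormedSpace ℝ X] {j : V →L[ℝ] X} {R : V → ℝ}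
    (h : IsAdmissibleDissipation j R) : IsSublinearPotential R := by
  obtain ⟨ρ₁, ρ₂, -, h2, hb⟩ := h.bounded
  refine ⟨h.nonneg, fun u v => ?_, h.posHomogeneous, ρ₂, h2, fun v => (hb v).2⟩
  have h1 := h.convex.2 (mem_univ ((2 : ℝ) • u)) (mem_univ ((2 : ℝ) • v))
    (by norm_num : (0 : ℝ) ≤ 1 / 2) (by norm_num : (0 : ℝ) ≤ 1 / 2) (by norm_num)
  rw [h.posHomogeneous 2 (by norm_num), h.posHomogeneous 2 (by norm_num), smul_smul, smul_smul] at h1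
  norm_num at h1
  linarith

end Dissipation

/-! ### Uniformly convex minimisation and the incremental problem. -/

section Minimisation

variable {Z : Type*} [NormedAddCommGroup Z] [InnerProductSpace ℝ Z]

/-- A continuous, bounded below, uniformly midpoint convex function on a complete space attains its
minimum. -/
theorem exists_forall_le_of_midpoint [CompleteSpace Z] {J : Z → ℝ} {c : ℝ} (hc : 0 < c)
    (hJ : Continuous J) (hbdd : BddBelow (range J))
    (hmid : ∀ x y, J ((1 / 2 : ℝ) • (x + y)) + c * ‖x - y‖ ^ 2 ≤ (J x + J y) / 2) :
    ∃ z, ∀ v, J z ≤ J v := by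
  set m := sInf (range J) with hm
  have hlow : ∀ v, m ≤ J v := fun v => csInf_le hbdd (mem_range_self v)
  have hex : ∀ n : ℕ, ∃ x, J x < m + 1 / (n + 1 : ℝ) := fun n => by
    obtain ⟨_, ⟨x, rfl⟩, hx⟩ := exists_lt_of_csInf_lt (range_nonempty J)
      (lt_add_of_pos_right m (by positivity : (0 : ℝ) < 1 / (n + 1 : ℝ)))
    exact ⟨x, hx⟩
  choose x hx using hex
  have hlim : Tendsto (fun n : ℕ => 1 / (n + 1 : ℝ)) atTop (𝓝 0) :=
    tendsto_one_div_add_atTop_nhds_zero_nat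
  have hsqrt : Tendsto (fun n : ℕ => √(1 / c * (1 / (n + 1 : ℝ)))) atTop (𝓝 0) := by
    simpa using (hlim.const_mul (1 / c)).sqrt
  -- Midpoints cannot go below the infimum, so uniform convexity forces `c‖x n - x k‖² ≤ 1/(N + 1)`.
  have hcau : CauchySeq x := by
    refine cauchySeq_of_le_tendsto_0 _ (fun n k N hn hk => ?_) hsqrt
    rw [dist_eq_norm]
    refine Real.le_sqrt_of_sq_le ?_
    have h1 := hmid (x n) (x k)
    have h2 := hlow ((1 / 2 : ℝ) • (x n + x k))
    have h3 : 1 / (n + 1 : ℝ) ≤ 1 / (N + 1 : ℝ) := by gcongr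
    have h4 : 1 / (k + 1 : ℝ) ≤ 1 / (N + 1 : ℝ) := by gcongr
    rw [one_div_mul_eq_div, le_div_iff₀ hc]
    nlinarith [hx n, hx k]
  obtain ⟨z, hz⟩ := cauchySeq_tendsto_of_complete hcau
  refine ⟨z, fun v => le_trans ?_ (hlow v)⟩
  have h1 : Tendsto (fun n => J (x n)) atTop (𝓝 (J z)) := (hJ.tendsto z).comp hz
  have h2 : Tendsto (fun n : ℕ => m + 1 / (n + 1 : ℝ)) atTop (𝓝 m) := by
    simpa using hlim.const_add m
  exact le_of_tendsto_of_tendsto' h1 h2 fun n => (hx n).le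

namespace IsEllipticOperator

variable {B : Z → StrongDual ℝ Z} {H : Z → Z →L[ℝ] StrongDual ℝ Z} {κ : ℝ} {e : Z → ℝ}

/-- Mean value theorem for `s ↦ e(x + s d) - (κ/2)‖d‖² s²`, whose derivative is at least `B x d` for
`s ≥ 0` by strong monotonicity. -/
theorem gradient_inequality (h : IsEllipticOperator B H κ) (he : ∀ z, HasFDerivAt e (B z) z)
    (x y : Z) : e x + B x (y - x) + κ / 2 * ‖y - x‖ ^ 2 ≤ e y := by
  set d := y - x with hd
  set φ : ℝ → ℝ := fun s => e (x + s • d) - κ / 2 * ‖d‖ ^ 2 * s ^ 2 with hφ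
  have hder : ∀ s, HasDerivAt φ (B (x + s • d) d - κ * ‖d‖ ^ 2 * s) s := by
    intro s
    have h1 : HasDerivAt (fun s : ℝ => x + s • d) d s := by
      simpa using ((hasDerivAt_id s).smul_const d).const_add x
    have h2 := ((he (x + s • d)).comp_hasDerivAt s h1).sub
      ((hasDerivAt_pow 2 s).const_mul (κ / 2 * ‖d‖ ^ 2))
    refine h2.congr_deriv ?_
    norm_num
    ring
  obtain ⟨s, hs0, hs⟩ := exists_hasDerivAt_eq_slope φ _ zero_lt_one
    (fun s _ => (hder s).continuousAt.continuousWithinAt) (fun s _ => hder s)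
  have hm := h.strongly_monotone (x + s • d) x
  rw [add_sub_cancel_left, norm_smul, map_smul, Real.norm_of_nonneg hs0.1.le, mul_pow,
    smul_eq_mul, sub_apply] at hm
  have hm' : κ * ‖d‖ ^ 2 * s ≤ B (x + s • d) d - B x d := by
    have := hs0.1
    nlinarith
  have e1 : x + (1 : ℝ) • d = y := by rw [hd]; simp
  simp only [hφ, e1, zero_smul, add_zero] at hs
  norm_num at hs
  linarith

/-- Solvability of the incremental problem of the implicit time discretisation. -/
theorem exists_incremental [CompleteSpace Z] (h : IsEllipticOperator B H κ)
    (he : ∀ z, HasFDerivAt e (B z) z) {Ψ : Z → ℝ} (hΨ : IsSublinearPotential Ψ)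
    (l : StrongDual ℝ Z) (z₀ : Z) : ∃ z, l - B z ∈ subdifferential Ψ (z - z₀) := by
  have hκ := h.pos
  have hec : Continuous e := continuous_iff_continuousAt.2 fun z => (he z).continuousAt
  have hBc : Continuous B := continuous_iff_continuousAt.2 fun z => (h.hasFDerivAt z).continuousAt
  -- `κ / 8` is the average of the two gradient inequalities at the midpoint, each contributing
  -- `(κ/2)·‖x - y‖²/4`. The lower bound on `J` comes from completing the square.
  obtain ⟨z, hz⟩ := exists_forall_le_of_midpoint (J := fun z => e z - l z + Ψ (z - z₀))
    (c := κ / 8) (by positivity)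
    ((hec.sub l.continuous).add (hΨ.continuous.comp (continuous_id.sub continuous_const)))
    (by
      refine ⟨e 0 - ‖B 0 - l‖ ^ 2 / (2 * κ), ?_⟩
      rintro _ ⟨y, rfl⟩
      have h1 := h.gradient_inequality he 0 y
      rw [sub_zero] at h1
      have h2 := (abs_le.1 ((B 0 - l).le_opNorm y)).1
      rw [sub_apply] at h2
      have h3 := hΨ.nonneg (y - z₀)
      have h4 : ‖B 0 - l‖ * ‖y‖ ≤ κ / 2 * ‖y‖ ^ 2 + ‖B 0 - l‖ ^ 2 / (2 * κ) := by
        have : κ / 2 * ‖y‖ ^ 2 + ‖B 0 - l‖ ^ 2 / (2 * κ) - ‖B 0 - l‖ * ‖y‖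
          = (κ * ‖y‖ - ‖B 0 - l‖) ^ 2 / (2 * κ) := by field_simp; ring
        have h5 : 0 ≤ (κ * ‖y‖ - ‖B 0 - l‖) ^ 2 / (2 * κ) := by positivity
        linarith
      dsimp only
      linarith)
    (by
      intro x y
      set m := (1 / 2 : ℝ) • (x + y) with hm
      have ex : x - m = (1 / 2 : ℝ) • (x - y) := by rw [hm]; module
      have ey : y - m = -((1 / 2 : ℝ) • (x - y)) := by rw [hm]; module
      have h1 := h.gradient_inequality he m x
      have h2 := h.gradient_inequality he m y
      rw [ex] at h1
      rw [ey, map_neg, norm_neg] at h2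
      have e1 : ‖(1 / 2 : ℝ) • (x - y)‖ ^ 2 = ‖x - y‖ ^ 2 / 4 := by
        rw [norm_smul]; norm_num; ring
      rw [e1] at h1 h2
      have hl : l m = (l x + l y) / 2 := by rw [hm, map_smul, map_add, smul_eq_mul]; ring
      have hΨm : Ψ (m - z₀) ≤ (Ψ (x - z₀) + Ψ (y - z₀)) / 2 := by
        have : m - z₀ = (1 / 2 : ℝ) • ((x - z₀) + (y - z₀)) := by rw [hm]; module
        rw [this, hΨ.smul _ (by norm_num)]
        linarith [hΨ.add_le (x - z₀) (y - z₀)]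
      rw [hl]
      linarith)
  refine ⟨z, fun w => ?_⟩
  set d := w - (z - z₀) with hd
  -- Compare `z` with `z + s d`, using convexity of `Ψ` and the gradient inequality based at `z + s
  -- d`, then divide by `s`. Continuity of `B` alone allows `s → 0`.
  have key : ∀ s : ℝ, 0 < s → s ≤ 1 → Ψ (z - z₀) + (l - B (z + s • d)) d ≤ Ψ w := by
    intro s hs hs1
    have h1 := hz (z + s • d)
    have h2 := h.gradient_inequality he (z + s • d) z
    have h3 : z - (z + s • d) = -(s • d) := by abel
    rw [h3, map_neg, map_smul, smul_eq_mul] at h2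
    have h4 : Ψ (z + s • d - z₀) ≤ (1 - s) * Ψ (z - z₀) + s * Ψ w := by
      have e1 : z + s • d - z₀ = (1 - s) • (z - z₀) + s • w := by rw [hd]; module
      rw [e1]
      refine (hΨ.add_le _ _).trans ?_
      rw [hΨ.smul s hs]
      rcases hs1.eq_or_lt with rfl | hs1
      · simp [hΨ.map_zero]
      · rw [hΨ.smul (1 - s) (by linarith)]
    have h5 : 0 ≤ κ / 2 * ‖-(s • d)‖ ^ 2 := by positivity
    simp only [map_add, map_smul, smul_eq_mul] at h1
    have h6 : s * (Ψ (z - z₀) + (l d - B (z + s • d) d)) ≤ s * Ψ w := by nlinarith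
    rw [sub_apply]
    exact le_of_mul_le_mul_left h6 hs
  have hcont : Tendsto (fun s : ℝ => Ψ (z - z₀) + (l - B (z + s • d)) d) (𝓝[>] 0)
      (𝓝 (Ψ (z - z₀) + (l - B z) d)) := by
    have hc : Continuous (fun s : ℝ => Ψ (z - z₀) + (l - B (z + s • d)) d) := by fun_prop
    have := hc.tendsto 0
    simp only [zero_smul, add_zero] at this
    exact this.mono_left nhdsWithin_le_nhds
  refine le_of_tendsto hcont ?_
  filter_upwards [Ioc_mem_nhdsGT zero_lt_one] with s hs
  exact key s hs.1 hs.2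

end IsEllipticOperator

end Minimisation

/-- Rate independence: increments may be replaced by difference quotients. -/
theorem IsSublinearPotential.smul_mem_subdifferential {E : Type*} [NormedAddCommGroup E]
    [NormedSpace ℝ E] {Ψ : E → ℝ} (h : IsSublinearPotential Ψ) {ξ : StrongDual ℝ E} {w : E}
    (hξ : ξ ∈ subdifferential Ψ w) {c : ℝ} (hc : 0 < c) : ξ ∈ subdifferential Ψ (c • w) := by
  rw [h.mem_subdifferential_iff] at hξ ⊢
  refine ⟨hξ.1, ?_⟩
  rw [h.smul c hc, map_smul, smul_eq_mul]
  exact mul_le_mul_of_nonneg_left hξ.2 hc.le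

theorem IsSublinearPotential.monotone_subdifferential {E : Type*} [NormedAddCommGroup E]
    [NormedSpace ℝ E] {Ψ : E → ℝ} (h : IsSublinearPotential Ψ) {ξ₁ ξ₂ : StrongDual ℝ E} {w₁ w₂ : E}
    (h₁ : ξ₁ ∈ subdifferential Ψ w₁) (h₂ : ξ₂ ∈ subdifferential Ψ w₂) :
    0 ≤ (ξ₁ - ξ₂) (w₁ - w₂) := by
  rw [h.mem_subdifferential_iff] at h₁ h₂
  have a := h₁.1 w₂
  have b := h₂.1 w₁
  simp only [sub_apply, map_sub]
  linarith [h₁.2, h₂.2]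

namespace IsPrimitiveOn

variable {E : Type*} [NormedAddCommGroup E] [NormedSpace ℝ E] {T : ℝ} {z g : ℝ → E}

theorem mono (h : IsPrimitiveOn T z g) {S : ℝ} (hS : S ∈ Icc 0 T) : IsPrimitiveOn S z g :=
  ⟨h.intervalIntegrable_of_mem ⟨le_rfl, hS.1.trans hS.2⟩ hS,
    fun t ht => h.eq_integral t ⟨ht.1, ht.2.trans hS.2⟩⟩

theorem norm_sub_le (h : IsPrimitiveOn T z g) {Λ : ℝ} (hg : ∀ t, ‖g t‖ ≤ Λ) {s t : ℝ}
    (hs : s ∈ Icc 0 T) (ht : t ∈ Icc 0 T) : ‖z t - z s‖ ≤ Λ * |t - s| := by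
  rw [h.sub_eq_integral hs ht]
  exact intervalIntegral.norm_integral_le_of_norm_le_const fun x _ => hg x

end IsPrimitiveOn

/-! ### Piecewise affine interpolation and implicit time discretisation. -/

section Interpolation

variable {E : Type*} [NormedAddCommGroup E] [NormedSpace ℝ E]

/-- The derivative of the piecewise affine interpolant of a sequence on a grid of width `τ`. -/
noncomputable def gridSlope (τ : ℝ) (x : ℕ → E) (t : ℝ) : E :=
  τ⁻¹ • (x (⌊t / τ⌋₊ + 1) - x ⌊t / τ⌋₊)

variable {τ Λ : ℝ} {x : ℕ → E}

theorem norm_gridSlope_le (hτ : 0 < τ) (hx : ∀ k, ‖x (k + 1) - x k‖ ≤ Λ * τ) (t : ℝ) :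
    ‖gridSlope τ x t‖ ≤ Λ := by
  rw [gridSlope, norm_smul, norm_inv, Real.norm_of_nonneg hτ.le, inv_mul_le_iff₀ hτ, mul_comm]
  exact hx _

theorem stronglyMeasurable_gridSlope (τ : ℝ) (x : ℕ → E) :
    StronglyMeasurable (gridSlope τ x) := by
  have h1 : StronglyMeasurable (fun k : ℕ => τ⁻¹ • (x (k + 1) - x k)) :=
    StronglyMeasurable.of_discrete
  exact h1.comp_measurable (Nat.measurable_floor.comp (measurable_id.div_const τ))

theorem intervalIntegrable_gridSlope (hτ : 0 < τ) (hx : ∀ k, ‖x (k + 1) - x k‖ ≤ Λ * τ)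
    (a b : ℝ) : IntervalIntegrable (gridSlope τ x) volume a b := by
  refine (intervalIntegrable_const (c := Λ)).mono_fun
    (stronglyMeasurable_gridSlope τ x).aestronglyMeasurable (Eventually.of_forall fun t => ?_)
  exact (norm_gridSlope_le hτ hx t).trans (le_abs_self _)

theorem integral_gridSlope [CompleteSpace E] (hτ : 0 < τ)
    (hx : ∀ k, ‖x (k + 1) - x k‖ ≤ Λ * τ) (k : ℕ) :
    ∫ s in 0..(k * τ), gridSlope τ x s = x k - x 0 := by
  induction k with
  | zero => simp
  | succ k ih =>
    have hle : (k : ℝ) * τ ≤ ((k + 1 : ℕ) : ℝ) * τ := by gcongr; simp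
    have hk : ∫ s in (k * τ)..((k + 1 : ℕ) * τ), gridSlope τ x s = x (k + 1) - x k := by
      have e1 : ∫ s in (k * τ)..((k + 1 : ℕ) * τ), gridSlope τ x s
          = ∫ _ in (k * τ)..((k + 1 : ℕ) * τ), τ⁻¹ • (x (k + 1) - x k) := by
        -- The open cell is needed: at the right node the floor already jumps to `k + 1`.
        rw [intervalIntegral.integral_of_le hle, intervalIntegral.integral_of_le hle,
          integral_Ioc_eq_integral_Ioo, integral_Ioc_eq_integral_Ioo]
        refine setIntegral_congr_fun measurableSet_Ioo fun s hs => ?_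
        have hfl : ⌊s / τ⌋₊ = k := by
          rw [Nat.floor_eq_iff (div_nonneg ((by positivity : (0 : ℝ) ≤ k * τ).trans hs.1.le) hτ.le),
            le_div_iff₀ hτ, div_lt_iff₀ hτ]
          exact ⟨hs.1.le, by simpa using hs.2⟩
        simp only [gridSlope, hfl]
      rw [e1, intervalIntegral.integral_const, smul_smul]
      have : ((k + 1 : ℕ) * τ - k * τ) * τ⁻¹ = 1 := by
        push_cast
        field_simp
        ring
      rw [this, one_smul]
    rw [← intervalIntegral.integral_add_adjacent_intervals
      (intervalIntegrable_gridSlope hτ hx 0 (k * τ)) (intervalIntegrable_gridSlope hτ hx _ _),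
      ih, hk]
    abel

end Interpolation

section Discretisation

variable {Z : Type*} [NormedAddCommGroup Z] [InnerProductSpace ℝ Z]

namespace IsEllipticOperator

variable {B : Z → StrongDual ℝ Z} {H : Z → Z →L[ℝ] StrongDual ℝ Z} {κ : ℝ} {e : Z → ℝ}

/-- Chain `(l₀ - B x)(y - x) ≤ Ψ(y - x) ≤ (l₁ - B y)(y - x)` with strong monotonicity: `κ‖y - x‖² ≤
(l₁ - l₀)(y - x)`. -/
theorem norm_increment_le (h : IsEllipticOperator B H κ) {Ψ : Z → ℝ}
    (hΨ : IsSublinearPotential Ψ) {l₀ l₁ : StrongDual ℝ Z} {x y : Z} {δ : ℝ}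
    (hl : ‖l₁ - l₀‖ ≤ δ) (hx : ∀ v, (l₀ - B x) v ≤ Ψ v)
    (hy : l₁ - B y ∈ subdifferential Ψ (y - x)) : ‖y - x‖ ≤ δ / κ := by
  have hy' := (hΨ.mem_subdifferential_iff.1 hy).2
  have hx' := hx (y - x)
  have hm := h.strongly_monotone y x
  have hl' := (abs_le.1 ((l₁ - l₀).le_of_opNorm_le hl (y - x))).2
  simp only [sub_apply] at hy' hx' hm hl'
  rw [le_div_iff₀ h.pos]
  rcases (norm_nonneg (y - x)).eq_or_lt with h0 | h0
  · rw [← h0, zero_mul]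
    exact (norm_nonneg _).trans hl
  · refine le_of_mul_le_mul_right ?_ h0
    nlinarith

/-- Piecewise affine approximate solutions, obtained by implicit time discretisation. -/
theorem exists_approximation [CompleteSpace Z] (h : IsEllipticOperator B H κ)
    (he : ∀ z, HasFDerivAt e (B z) z) {Ψ : Z → ℝ} (hΨ : IsSublinearPotential Ψ)
    {l : ℝ → StrongDual ℝ Z} {L T : ℝ} (hL : 0 ≤ L) (hT : 0 ≤ T)
    (hl : ∀ s t, ‖l t - l s‖ ≤ L * |t - s|)
    {z₀ : Z} (hz₀ : l 0 - B z₀ ∈ subdifferential Ψ 0) :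
    ∃ Λ K r : ℝ, 0 ≤ Λ ∧ 0 ≤ K ∧ 0 < r ∧
      (∀ x ∈ Metric.ball (0 : Z) r, ∀ y ∈ Metric.ball (0 : Z) r, ‖B x - B y‖ ≤ K * ‖x - y‖) ∧
      ∀ τ : ℝ, 0 < τ → τ ≤ 1 → ∃ z g : ℝ → Z, IsPrimitiveOn T z g ∧ z 0 = z₀ ∧
        (∀ t, ‖g t‖ ≤ Λ) ∧ (∀ t ∈ Icc 0 T, z t ∈ Metric.ball (0 : Z) r) ∧
        ∀ t ∈ Icc 0 T, ∃ ξ ∈ subdifferential Ψ (g t), ‖ξ - (l t - B (z t))‖ ≤ K * τ := by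
  have hκ := h.pos
  set Λ := L / κ with hΛ
  have hΛ0 : 0 ≤ Λ := div_nonneg hL hκ.le
  -- `T + 1`, because the right node of the cell containing `t ≤ T` may lie beyond `T`, by at most
  -- `τ ≤ 1`.
  set r := ‖z₀‖ + Λ * (T + 1) + 1 with hr
  have hr0 : 0 < r := by positivity
  obtain ⟨C, hC, hb⟩ := h.exists_taylor hr0
  refine ⟨Λ, C + (L + C * Λ), r, hΛ0, by positivity, hr0, fun x hx y hy => ?_, ?_⟩
  · refine (hb x hx y hy).1.trans ?_
    gcongr
    have : 0 ≤ L + C * Λ := by positivity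
    linarith
  intro τ hτ hτ1
  choose step hstep using fun (l' : StrongDual ℝ Z) (z' : Z) => h.exists_incremental he hΨ l' z'
  let x : ℕ → Z := fun k => Nat.rec z₀ (fun k z' => step (l ((k + 1 : ℕ) * τ)) z') k
  have hx0 : x 0 = z₀ := rfl
  have hxs : ∀ k : ℕ, l ((k + 1 : ℕ) * τ) - B (x (k + 1)) ∈ subdifferential Ψ (x (k + 1) - x k) :=
    fun k => hstep _ _
  -- Local stability of `z₀` starts the iteration; afterwards each minimiser is stable for its own
  -- load.
  have hstab : ∀ k : ℕ, ∀ v, (l (k * τ) - B (x k)) v ≤ Ψ v := fun k => by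
    cases k with
    | zero =>
      rw [hx0, Nat.cast_zero, zero_mul]
      exact (hΨ.mem_subdifferential_iff.1 hz₀).1
    | succ k => exact (hΨ.mem_subdifferential_iff.1 (hxs k)).1
  have hinc : ∀ k, ‖x (k + 1) - x k‖ ≤ Λ * τ := fun k => by
    have := h.norm_increment_le hΨ (hl (k * τ) ((k + 1 : ℕ) * τ)) (hstab k) (hxs k)
    refine this.trans_eq ?_
    have e1 : ((k + 1 : ℕ) * τ - k * τ) = τ := by push_cast; ring
    rw [e1, abs_of_pos hτ, hΛ]
    ring
  set g := gridSlope τ x with hg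
  have hgΛ : ∀ t, ‖g t‖ ≤ Λ := norm_gridSlope_le hτ hinc
  set z : ℝ → Z := fun t => z₀ + ∫ s in 0..t, g s with hz
  have hz0 : z 0 = z₀ := by simp [hz]
  have hprim : ∀ S, IsPrimitiveOn S z g := fun S =>
    ⟨intervalIntegrable_gridSlope hτ hinc 0 S, fun t _ => by rw [hz0]⟩
  have hnode : ∀ k : ℕ, z (k * τ) = x k := fun k => by
    simp only [hz, hg, integral_gridSlope hτ hinc k, hx0]
    abel
  have hball : ∀ t ∈ Icc 0 (T + 1), z t ∈ Metric.ball (0 : Z) r := fun t ht => by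
    have h1 := (hprim (T + 1)).norm_sub_le hgΛ ⟨le_rfl, by linarith⟩ ht
    rw [hz0, sub_zero, abs_of_nonneg ht.1] at h1
    have h2 : ‖z t‖ ≤ ‖z₀‖ + ‖z t - z₀‖ := by
      simpa using norm_add_le z₀ (z t - z₀)
    rw [mem_ball_zero_iff, hr]
    have : Λ * t ≤ Λ * (T + 1) := by gcongr; exact ht.2
    linarith
  refine ⟨z, g, hprim T, hz0, hgΛ, fun t ht => hball t ⟨ht.1, by linarith [ht.2]⟩,
    fun t ht => ?_⟩
  set k := ⌊t / τ⌋₊ with hk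
  have hk1 : (k : ℝ) * τ ≤ t := by
    rw [← le_div_iff₀ hτ]; exact Nat.floor_le (div_nonneg ht.1 hτ.le)
  have hk2 : t < ((k + 1 : ℕ) : ℝ) * τ := by
    rw [← div_lt_iff₀ hτ]; exact_mod_cast Nat.lt_floor_add_one (t / τ)
  have hk3 : ((k + 1 : ℕ) : ℝ) * τ = k * τ + τ := by push_cast; ring
  -- The exact inclusion holds at the right node of the cell; moving it to `t` costs at most `(L + C
  -- Λ) τ`.
  refine ⟨l ((k + 1 : ℕ) * τ) - B (x (k + 1)),
    hΨ.smul_mem_subdifferential (hxs k) (inv_pos.2 hτ), ?_⟩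
  set t' := ((k + 1 : ℕ) : ℝ) * τ with ht'
  have htm : t ∈ Icc 0 (T + 1) := ⟨ht.1, by linarith [ht.2]⟩
  have htm' : t' ∈ Icc 0 (T + 1) := ⟨by positivity, by linarith [ht.2]⟩
  have habs : |t' - t| ≤ τ := by rw [abs_of_nonneg (by linarith)]; linarith
  rw [← hnode (k + 1), ← ht']
  have e1 : l t' - B (z t') - (l t - B (z t)) = (l t' - l t) - (B (z t') - B (z t)) := by abel
  have n1 : ‖l t' - l t‖ ≤ L * τ := (hl t t').trans (by gcongr)
  have n2 : ‖z t' - z t‖ ≤ Λ * τ :=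
    ((hprim (T + 1)).norm_sub_le hgΛ htm htm').trans (by gcongr)
  have n3 : ‖B (z t') - B (z t)‖ ≤ C * (Λ * τ) :=
    (hb _ (hball t' htm') _ (hball t htm)).1.trans (by gcongr)
  rw [e1]
  refine (_root_.norm_sub_le _ _).trans ?_
  have : 0 ≤ C * τ := by positivity
  nlinarith

end IsEllipticOperator

end Discretisation

/-! ### Weak compactness and limits of primitives. -/

section WeakLimit

variable {Z : Type*} [NormedAddCommGroup Z] [InnerProductSpace ℝ Z] [CompleteSpace Z]

/-- Bounded sequences in a Hilbert space have weak limits along some ultrafilter. -/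
theorem exists_weak_limit_of_bounded {u : ℕ → Z} {r : ℝ} (hu : ∀ n, ‖u n‖ ≤ r) :
    ∃ x : Z, ∃ U : Ultrafilter ℕ, (U : Filter ℕ) ≤ atTop ∧
      ∀ f : Z, Tendsto (fun n => inner ℝ (u n) f) U (𝓝 (inner ℝ x f)) := by
  let D : ℕ → WeakDual ℝ Z := fun n =>
    StrongDual.toWeakDual (InnerProductSpace.toDual ℝ Z (u n))
  have hK := WeakDual.isCompact_closedBall (𝕜 := ℝ) (E := Z) 0 r
  -- An ultrafilter instead of a subsequence: Banach–Alaoglu then needs no separability.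
  let U : Ultrafilter ℕ := Ultrafilter.of atTop
  have hD : ∀ n, D n ∈ WeakDual.toStrongDual ⁻¹' Metric.closedBall (0 : StrongDual ℝ Z) r := by
    intro n
    rw [mem_preimage, mem_closedBall_zero_iff]
    exact (LinearIsometryEquiv.norm_map (InnerProductSpace.toDual ℝ Z) (u n)).trans_le (hu n)
  obtain ⟨x, -, hx⟩ := hK.ultrafilter_le_nhds (U.map D)
    (le_principal_iff.2 (Ultrafilter.mem_map.2 (univ_mem' hD)))
  refine ⟨(InnerProductSpace.toDual ℝ Z).symm (WeakDual.toStrongDual x), U,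
    Ultrafilter.of_le _, fun f => ?_⟩
  have h1 : Tendsto (fun n => D n f) U (𝓝 (x f)) :=
    ((WeakDual.eval_continuous f).tendsto x).comp hx
  rw [InnerProductSpace.toDual_symm_apply]
  exact h1

/-- A pointwise limit of primitives of uniformly bounded functions is again a primitive. -/
theorem IsPrimitiveOn.exists_of_tendsto {T Λ : ℝ} (hT : 0 ≤ T) {z g : ℕ → ℝ → Z} {y : ℝ → Z}
    (h : ∀ n, IsPrimitiveOn T (z n) (g n)) (hg : ∀ n t, ‖g n t‖ ≤ Λ)
    (hz : ∀ t ∈ Icc 0 T, Tendsto (fun n => z n t) atTop (𝓝 (y t))) :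
    ∃ γ : ℝ → Z, IsPrimitiveOn T y γ := by
  set μ := volume.restrict (Ioc 0 T) with hμ
  have hmem : ∀ n, MemLp (g n) 2 μ := fun n =>
    MemLp.of_bound (h n).intervalIntegrable.1.aestronglyMeasurable Λ
      (Eventually.of_forall (hg n))
  obtain ⟨x, U, hU, hx⟩ := exists_weak_limit_of_bounded (u := fun n => (hmem n).toLp (g n))
    (r := (μ.real univ) ^ (ENNReal.toReal 2)⁻¹ * |Λ|) (fun n => by
      refine Lp.norm_le_of_ae_bound (abs_nonneg Λ) ?_
      filter_upwards [(hmem n).coeFn_toLp] with t ht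
      rw [ht]
      exact (hg n t).trans (le_abs_self _))
  have hxint : Integrable x μ := (Lp.memLp x).integrable one_le_two
  refine ⟨x, ?_, fun t ht => ?_⟩
  · rw [intervalIntegrable_iff_integrableOn_Ioc_of_le hT]
    exact hxint
  have hres : μ.restrict (Ioc 0 t) = volume.restrict (Ioc 0 t) := by
    rw [hμ, Measure.restrict_restrict measurableSet_Ioc,
      inter_eq_left.2 (Ioc_subset_Ioc_right ht.2)]
  have hfin : μ (Ioc 0 t) ≠ ⊤ := measure_ne_top _ _
  have h0 : (0 : ℝ) ∈ Icc 0 T := ⟨le_rfl, hT⟩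
  rw [← sub_eq_iff_eq_add']
  refine ext_inner_left ℝ fun c => ?_
  -- Testing the weak `L²` limit with `1_{(0,t]} c` recovers the increment of `y` over `[0, t]`.
  have h1 := hx (indicatorConstLp 2 (measurableSet_Ioc (a := 0) (b := t)) hfin c)
  have e1 : ∀ n, inner ℝ ((hmem n).toLp (g n))
      (indicatorConstLp 2 (measurableSet_Ioc (a := 0) (b := t)) hfin c)
      = inner ℝ c (z n t - z n 0) := fun n => by
    rw [real_inner_comm, L2.inner_indicatorConstLp_eq_inner_setIntegral, hres,
      (h n).sub_eq_integral h0 ht, intervalIntegral.integral_of_le ht.1]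
    congr 1
    refine setIntegral_congr_ae measurableSet_Ioc ?_
    have := (ae_restrict_iff' measurableSet_Ioc).1 (hmem n).coeFn_toLp
    filter_upwards [this] with s hs hst
    exact hs ⟨hst.1, hst.2.trans ht.2⟩
  simp only [e1] at h1
  rw [real_inner_comm, L2.inner_indicatorConstLp_eq_inner_setIntegral, hres,
    ← intervalIntegral.integral_of_le ht.1] at h1
  have h2 : Tendsto (fun n => inner ℝ c (z n t - z n 0)) U (𝓝 (inner ℝ c (y t - y 0))) :=
    (tendsto_const_nhds.inner ((hz t ht).sub (hz 0 h0))).mono_left hU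
  exact tendsto_nhds_unique h2 h1

end WeakLimit

/-! ### Convergence of the scheme, existence and uniqueness. -/

section Existence

variable {Z : Type*} [NormedAddCommGroup Z] [InnerProductSpace ℝ Z] [CompleteSpace Z]

namespace IsEllipticOperator

variable {B : Z → StrongDual ℝ Z} {H : Z → Z →L[ℝ] StrongDual ℝ Z} {κ : ℝ} {e : Z → ℝ}

/-- The implicit time discretisations converge uniformly. -/
theorem exists_uniform_approximation (h : IsEllipticOperator B H κ)
    (he : ∀ z, HasFDerivAt e (B z) z) {Ψ : Z → ℝ} (hΨ : IsSublinearPotential Ψ)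
    {l : ℝ → StrongDual ℝ Z} {L T : ℝ} (hL : 0 ≤ L) (hT : 0 ≤ T)
    (hl : ∀ s t, ‖l t - l s‖ ≤ L * |t - s|)
    {z₀ : Z} (hz₀ : l 0 - B z₀ ∈ subdifferential Ψ 0) :
    ∃ (Λ K : ℝ) (z g : ℕ → ℝ → Z) (y : ℝ → Z) (δ : ℕ → ℝ), 0 ≤ Λ ∧ 0 ≤ K ∧ y 0 = z₀ ∧
      Tendsto δ atTop (𝓝 0) ∧ (∀ n, IsPrimitiveOn T (z n) (g n)) ∧ (∀ n t, ‖g n t‖ ≤ Λ) ∧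
      (∀ n, ∀ t ∈ Icc 0 T, ‖z n t - y t‖ ≤ δ n) ∧
      (∀ n, ∀ t ∈ Icc 0 T, ∃ ξ ∈ subdifferential Ψ (g n t), ‖ξ - (l t - B (y t))‖ ≤ δ n) ∧
      ∀ s ∈ Icc 0 T, ∀ t ∈ Icc 0 T, ‖B (y t) - B (y s)‖ ≤ K * ‖y t - y s‖ := by
  have hκ := h.pos
  obtain ⟨Λ, K, r, hΛ, hK, hr, hlip, happ⟩ := h.exists_approximation he hΨ hL hT hl hz₀
  obtain ⟨C, hC, hstab⟩ := h.stability hr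
  set τ : ℕ → ℝ := fun n => 1 / (n + 1 : ℝ) with hτdef
  have hτ0 : ∀ n, 0 < τ n := fun n => by positivity
  have hτ1 : ∀ n, τ n ≤ 1 := fun n => by
    rw [hτdef]; dsimp only; rw [div_le_one (by positivity)]
    linarith [(Nat.cast_nonneg n : (0 : ℝ) ≤ n)]
  have hτlim : Tendsto τ atTop (𝓝 0) := tendsto_one_div_add_atTop_nhds_zero_nat
  choose z g hprim hz0 hgΛ hball hξ using fun n => happ (τ n) (hτ0 n) (hτ1 n)
  set D := 8 * (K * Λ) * T * Real.exp (C * (2 * Λ) * T) / κ with hD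
  have hD0 : 0 ≤ D := by positivity
  have hcau : ∀ t ∈ Icc 0 T, ∀ n m N : ℕ, N ≤ n → N ≤ m →
      dist (z n t) (z m t) ≤ √(D * τ N) := by
    intro t ht n m N hn hm
    have hsub : ∀ s, s ∈ Icc 0 t → s ∈ Icc 0 T := fun s hs => ⟨hs.1, hs.2.trans ht.2⟩
    have hn' : τ n ≤ τ N := by simp only [hτdef]; gcongr
    have hm' : τ m ≤ τ N := by simp only [hτdef]; gcongr
    -- `4KΛτ`: two residuals, each at most `K τ N`, tested with slopes differing by at most `2Λ`.
    have hε : 0 ≤ 4 * (K * Λ) * τ N := by have := hτ0 N; positivity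
    have key := hstab t (4 * (K * Λ) * τ N) (z n) (z m) (g n) (g m) ht.1 hε
      ((hprim n).mono ht) ((hprim m).mono ht) (by rw [hz0, hz0])
      (fun s hs => hball n s (hsub s hs)) (fun s hs => hball m s (hsub s hs))
      (Eventually.of_forall fun s hs => by
        obtain ⟨ξ₁, h₁, b₁⟩ := hξ n s (hsub s (Ioo_subset_Icc_self hs))
        obtain ⟨ξ₂, h₂, b₂⟩ := hξ m s (hsub s (Ioo_subset_Icc_self hs))
        have hmono := hΨ.monotone_subdifferential h₁ h₂
        have hb₁ : ‖ξ₁ - (l s - B (z n s))‖ ≤ K * τ N := b₁.trans (by gcongr)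
        have hb₂ : ‖ξ₂ - (l s - B (z m s))‖ ≤ K * τ N := b₂.trans (by gcongr)
        have hg : ‖g n s - g m s‖ ≤ 2 * Λ :=
          (norm_sub_le _ _).trans (by linarith [hgΛ n s, hgΛ m s])
        have a₁ := (abs_le.1 ((ContinuousLinearMap.le_of_opNorm_le _ hb₁ (g n s - g m s)).trans
          (mul_le_mul_of_nonneg_left hg (by have := hτ0 N; positivity)))).2
        have a₂ := (abs_le.1 ((ContinuousLinearMap.le_of_opNorm_le _ hb₂ (g n s - g m s)).trans
          (mul_le_mul_of_nonneg_left hg (by have := hτ0 N; positivity)))).1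
        simp only [sub_apply] at hmono a₁ a₂ ⊢
        linarith)
    have hint : ∫ s in 0..t, C * (‖g n s‖ + ‖g m s‖) ≤ C * (2 * Λ) * T := by
      have hi : IntervalIntegrable (fun s => C * (‖g n s‖ + ‖g m s‖)) volume 0 t :=
        ((((hprim n).mono ht).intervalIntegrable.norm).add
          (((hprim m).mono ht).intervalIntegrable.norm)).const_mul C
      calc ∫ s in 0..t, C * (‖g n s‖ + ‖g m s‖) ≤ ∫ _ in 0..t, C * (2 * Λ) := by
            refine intervalIntegral.integral_mono_on ht.1 hi intervalIntegrable_const fun s _ => ?_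
            gcongr
            linarith [hgΛ n s, hgΛ m s]
        _ = C * (2 * Λ) * t := by rw [intervalIntegral.integral_const]; simp [mul_comm]
        _ ≤ C * (2 * Λ) * T := by gcongr; exact ht.2
    rw [dist_eq_norm]
    refine Real.le_sqrt_of_sq_le ?_
    have e1 : D * τ N = 2 * (4 * (K * Λ) * τ N) * T * Real.exp (C * (2 * Λ) * T) / κ := by
      rw [hD]; ring
    rw [e1, le_div_iff₀ hκ, mul_comm]
    refine key.trans ?_
    gcongr
    exact ht.2
  have hsq : Tendsto (fun n => √(D * τ n)) atTop (𝓝 0) := by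
    simpa using (hτlim.const_mul D).sqrt
  have hex : ∀ t, ∃ y, t ∈ Icc 0 T → Tendsto (fun n => z n t) atTop (𝓝 y) := fun t => by
    by_cases ht : t ∈ Icc 0 T
    · obtain ⟨y, hy⟩ := cauchySeq_tendsto_of_complete
        (cauchySeq_of_le_tendsto_0 _ (fun n m N hn hm => hcau t ht n m N hn hm) hsq)
      exact ⟨y, fun _ => hy⟩
    · exact ⟨0, fun h => absurd h ht⟩
  choose y hy using hex
  have hzy : ∀ n, ∀ t ∈ Icc 0 T, ‖z n t - y t‖ ≤ √(D * τ n) := fun n t ht => by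
    rw [← dist_eq_norm]
    refine le_of_tendsto ((tendsto_const_nhds (x := z n t)).dist (hy t ht)) ?_
    filter_upwards [eventually_ge_atTop n] with m hm
    exact hcau t ht n m n le_rfl hm
  have h0 : (0 : ℝ) ∈ Icc 0 T := ⟨le_rfl, hT⟩
  -- The limit lies only in the closed ball of radius `r`, hence the enlarged radius.
  have hyball : ∀ t ∈ Icc 0 T, y t ∈ Metric.ball (0 : Z) (r + 1) := fun t ht => by
    have := le_of_tendsto (hy t ht).norm
      (Eventually.of_forall fun n => (mem_ball_zero_iff.1 (hball n t ht)).le)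
    rw [mem_ball_zero_iff]
    linarith
  obtain ⟨K', hK', hB'⟩ := h.exists_taylor (by linarith : 0 < r + 1)
  have hzball : ∀ n, ∀ t ∈ Icc 0 T, z n t ∈ Metric.ball (0 : Z) (r + 1) := fun n t ht =>
    Metric.ball_subset_ball (by linarith) (hball n t ht)
  -- `δ` collects the discretisation residual, the uniform distance to `y`, and the cost of
  -- replacing `B (z n t)` by `B (y t)`.
  refine ⟨Λ, K', z, g, y, fun n => K * τ n + (1 + K') * √(D * τ n), hΛ, hK', ?_, ?_, hprim, hgΛ,
    fun n t ht => ?_, fun n t ht => ?_, fun s hs t ht => (hB' _ (hyball t ht) _ (hyball s hs)).1⟩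
  · refine tendsto_nhds_unique (hy 0 h0) ?_
    simp only [hz0]
    exact tendsto_const_nhds
  · simpa using (hτlim.const_mul K).add (hsq.const_mul (1 + K'))
  · have h1 : 0 ≤ K * τ n := by have := hτ0 n; positivity
    have h2 : 0 ≤ K' * √(D * τ n) := by positivity
    linarith [hzy n t ht]
  · obtain ⟨ξ, h₁, b₁⟩ := hξ n t ht
    refine ⟨ξ, h₁, ?_⟩
    have e1 : ξ - (l t - B (y t)) = (ξ - (l t - B (z n t))) - (B (z n t) - B (y t)) := by abel
    have n1 : ‖B (z n t) - B (y t)‖ ≤ K' * √(D * τ n) :=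
      (hB' _ (hzball n t ht) _ (hyball t ht)).1.trans (by gcongr; exact hzy n t ht)
    rw [e1]
    refine (norm_sub_le _ _).trans ?_
    have : 0 ≤ √(D * τ n) := Real.sqrt_nonneg _
    linarith

/-- Existence of Lipschitz solutions of the rate-independent differential inclusion. -/
theorem exists_solution (h : IsEllipticOperator B H κ)
    (he : ∀ z, HasFDerivAt e (B z) z) {Ψ : Z → ℝ} (hΨ : IsSublinearPotential Ψ)
    {l : ℝ → StrongDual ℝ Z} {L T : ℝ} (hL : 0 ≤ L) (hT : 0 ≤ T)
    (hl : ∀ s t, ‖l t - l s‖ ≤ L * |t - s|)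
    {z₀ : Z} (hz₀ : l 0 - B z₀ ∈ subdifferential Ψ 0) :
    ∃ (y γ : ℝ → Z) (Λ : ℝ), y 0 = z₀ ∧ IsPrimitiveOn T y γ ∧
      (∀ᵐ t, t ∈ Ioo 0 T → ‖γ t‖ ≤ Λ) ∧
      ∀ᵐ t, t ∈ Ioo 0 T → l t - B (y t) ∈ subdifferential Ψ (γ t) := by
  obtain ⟨Λ, K, z, g, y, δ, hΛ, hK, hy0, hδ, hprim, hgΛ, hzy, hξ, hB⟩ :=
    h.exists_uniform_approximation he hΨ hL hT hl hz₀
  have hlim : ∀ t ∈ Icc 0 T, Tendsto (fun n => z n t) atTop (𝓝 (y t)) := fun t ht =>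
    tendsto_iff_norm_sub_tendsto_zero.2
      (squeeze_zero (fun n => norm_nonneg _) (fun n => hzy n t ht) hδ)
  obtain ⟨γ, hγ⟩ := IsPrimitiveOn.exists_of_tendsto hT hprim hgΛ hlim
  have hyΛ : ∀ s ∈ Icc 0 T, ∀ t ∈ Icc 0 T, ‖y t - y s‖ ≤ Λ * |t - s| := fun s hs t ht =>
    le_of_tendsto ((hlim t ht).sub (hlim s hs)).norm
      (Eventually.of_forall fun n => (hprim n).norm_sub_le (hgΛ n) hs ht)
  have hstable : ∀ t ∈ Icc 0 T, ∀ v, (l t - B (y t)) v ≤ Ψ v := fun t ht v => by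
    have h1 : Tendsto (fun n => Ψ v + δ n * ‖v‖) atTop (𝓝 (Ψ v)) := by
      simpa using (hδ.mul_const ‖v‖).const_add (Ψ v)
    refine ge_of_tendsto h1 (Eventually.of_forall fun n => ?_)
    obtain ⟨ξ, h₁, b₁⟩ := hξ n t ht
    have h2 := (hΨ.mem_subdifferential_iff.1 h₁).1 v
    have h3 := (abs_le.1 (ContinuousLinearMap.le_of_opNorm_le _ b₁ v)).1
    rw [sub_apply] at h3
    linarith
  set M := L + K * Λ with hM
  have hM0 : 0 ≤ M := by positivity
  have hξlip : ∀ s ∈ Icc 0 T, ∀ t ∈ Icc 0 T,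
      ‖(l t - B (y t)) - (l s - B (y s))‖ ≤ M * |t - s| := fun s hs t ht => by
    have e1 : (l t - B (y t)) - (l s - B (y s)) = (l t - l s) - (B (y t) - B (y s)) := by abel
    rw [e1]
    refine (norm_sub_le _ _).trans ?_
    have h2 : ‖B (y t) - B (y s)‖ ≤ K * (Λ * |t - s|) :=
      (hB s hs t ht).trans (by gcongr; exact hyΛ s hs t ht)
    rw [hM]
    linarith [hl s t]
  -- Along the approximations `ζ(g) ≤ Ψ(g) ≤ ξ(g)`, with `ξ` close to `l - B y` at time `s` by
  -- Lipschitz continuity. Integrating over `[s, t]` and letting `n → ∞` leaves a quadratic error,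
  -- negligible after division by `t - s`; no semicontinuity of `∫ Ψ` is involved.
  have hdiss : ∀ ζ : StrongDual ℝ Z, (∀ v, ζ v ≤ Ψ v) → ∀ s ∈ Icc 0 T, ∀ t ∈ Icc 0 T, s ≤ t →
      (ζ - (l s - B (y s))) (y t - y s) ≤ M * Λ * (t - s) ^ 2 := by
    intro ζ hζ s hs t ht hst
    have h1 : ∀ n, (ζ - (l s - B (y s))) (z n t - z n s)
        ≤ (δ n + M * (t - s)) * Λ * (t - s) := by
      intro n
      have hi := (hprim n).intervalIntegrable_of_mem hs ht
      rw [(hprim n).sub_eq_integral hs ht,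
        ← ContinuousLinearMap.intervalIntegral_comp_comm _ hi]
      calc ∫ r in s..t, (ζ - (l s - B (y s))) (g n r)
          ≤ ∫ _ in s..t, (δ n + M * (t - s)) * Λ := by
            refine intervalIntegral.integral_mono_on hst
              ⟨ContinuousLinearMap.integrable_comp _ hi.1, ContinuousLinearMap.integrable_comp _ hi.2⟩
              intervalIntegrable_const
              fun r hr => ?_
            have hrT : r ∈ Icc 0 T := ⟨hs.1.trans hr.1, hr.2.trans ht.2⟩
            obtain ⟨ξ, h₁, b₁⟩ := hξ n r hrT
            have h2 := (hΨ.mem_subdifferential_iff.1 h₁).2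
            have h3 := hζ (g n r)
            have b₂ := hξlip s hs r hrT
            have b₃ : ‖ξ - (l s - B (y s))‖ ≤ δ n + M * (t - s) := by
              have e1 : ξ - (l s - B (y s)) = (ξ - (l r - B (y r))) +
                ((l r - B (y r)) - (l s - B (y s))) := by abel
              rw [e1]
              refine (norm_add_le _ _).trans (add_le_add b₁ (b₂.trans ?_))
              rw [abs_of_nonneg (sub_nonneg.2 hr.1)]
              gcongr
              exact hr.2
            have h4 := (abs_le.1 ((ContinuousLinearMap.le_of_opNorm_le _ b₃ (g n r)).trans
              (mul_le_mul_of_nonneg_left (hgΛ n r) ((norm_nonneg _).trans b₃)))).2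
            simp only [sub_apply] at h4 ⊢
            linarith
        _ = (δ n + M * (t - s)) * Λ * (t - s) := by
            rw [intervalIntegral.integral_const, smul_eq_mul, mul_comm]
    have h2 : Tendsto (fun n => (ζ - (l s - B (y s))) (z n t - z n s)) atTop
        (𝓝 ((ζ - (l s - B (y s))) (y t - y s))) :=
      ((ζ - (l s - B (y s))).continuous.tendsto _).comp ((hlim t ht).sub (hlim s hs))
    have h3 : Tendsto (fun n => (δ n + M * (t - s)) * Λ * (t - s)) atTop
        (𝓝 ((0 + M * (t - s)) * Λ * (t - s))) :=
      ((hδ.add_const _).mul_const _).mul_const _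
    refine (le_of_tendsto_of_tendsto' h2 h3 h1).trans_eq ?_
    ring
  refine ⟨y, γ, Λ, hy0, hγ, ?_, ?_⟩
  · filter_upwards [hγ.ae_hasDerivAt] with t ht htT
    have := (ht htT).hasFDerivAt.le_of_lip' hΛ (by
      filter_upwards [Ioo_mem_nhds htT.1 htT.2] with s hs
      exact hyΛ t (Ioo_subset_Icc_self htT) s (Ioo_subset_Icc_self hs))
    simpa using this
  · filter_upwards [hγ.ae_hasDerivAt] with t ht htT
    have htI := Ioo_subset_Icc_self htT
    rw [hΨ.mem_subdifferential_iff]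
    refine ⟨hstable t htI, ?_⟩
    -- For `ζ` supporting `Ψ` at `γ t`, the quotient of `hdiss` as `s ↓ t` gives `Ψ(γ t) = ζ(γ t) ≤
    -- (l t - B (y t))(γ t)`.
    obtain ⟨ζ, hζ, hζγ⟩ := hΨ.exists_support (γ t)
    have hslope : Tendsto (fun s => (ζ - (l t - B (y t))) (slope y t s)) (𝓝[>] t)
        (𝓝 ((ζ - (l t - B (y t))) (γ t))) :=
      ((ζ - (l t - B (y t))).continuous.tendsto _).comp
        ((hasDerivAt_iff_tendsto_slope.1 (ht htT)).mono_left
          (nhdsWithin_mono _ fun s hs => ne_of_gt hs))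
    have hbound : Tendsto (fun s => M * Λ * (s - t)) (𝓝[>] t) (𝓝 0) := by
      have hc : Continuous fun s => M * Λ * (s - t) := by fun_prop
      have := hc.tendsto t
      simp only [sub_self, mul_zero] at this
      exact this.mono_left nhdsWithin_le_nhds
    have hle := le_of_tendsto_of_tendsto hslope hbound (by
      filter_upwards [Ioo_mem_nhdsGT htT.2] with s hs
      have hst : 0 < s - t := sub_pos.2 hs.1
      have := hdiss ζ hζ t htI s ⟨htI.1.trans hs.1.le, hs.2.le⟩ hs.1.le
      rw [slope_def_module, map_smul, smul_eq_mul, inv_mul_le_iff₀ hst]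
      refine this.trans_eq ?_
      ring)
    rw [sub_apply, hζγ] at hle
    linarith

/-- Absolutely continuous solutions with the same initial value coincide. -/
theorem solution_unique (h : IsEllipticOperator B H κ) {Ψ : Z → ℝ}
    (hΨ : IsSublinearPotential Ψ) {l : ℝ → StrongDual ℝ Z} {T : ℝ} {z₁ z₂ g₁ g₂ : ℝ → Z}
    (h₁ : IsPrimitiveOn T z₁ g₁) (h₂ : IsPrimitiveOn T z₂ g₂) (h0 : z₁ 0 = z₂ 0)
    (hs₁ : ∀ᵐ t, t ∈ Ioo 0 T → l t - B (z₁ t) ∈ subdifferential Ψ (g₁ t))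
    (hs₂ : ∀ᵐ t, t ∈ Ioo 0 T → l t - B (z₂ t) ∈ subdifferential Ψ (g₂ t)) :
    EqOn z₁ z₂ (Icc 0 T) := by
  intro t ht
  have hT := ht.1.trans ht.2
  have hbd : ∀ {z g : ℝ → Z}, IsPrimitiveOn T z g → ∃ r, ∀ s ∈ Icc 0 T, ‖z s‖ ≤ r :=
    fun hz => isCompact_Icc.exists_bound_of_continuousOn (hz.continuousOn hT)
  obtain ⟨r₁, hr₁⟩ := hbd h₁
  obtain ⟨r₂, hr₂⟩ := hbd h₂
  have hr : 0 < |r₁| + |r₂| + 1 := by positivity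
  obtain ⟨C, hC, hstab⟩ := h.stability hr
  have hsub : ∀ s, s ∈ Icc 0 t → s ∈ Icc 0 T := fun s hs => ⟨hs.1, hs.2.trans ht.2⟩
  have key := hstab t 0 z₁ z₂ g₁ g₂ ht.1 le_rfl (h₁.mono ht) (h₂.mono ht) h0
    (fun s hs => by
      rw [mem_ball_zero_iff]
      linarith [hr₁ s (hsub s hs), le_abs_self r₁, abs_nonneg r₂])
    (fun s hs => by
      rw [mem_ball_zero_iff]
      linarith [hr₂ s (hsub s hs), le_abs_self r₂, abs_nonneg r₁])
    (by
      filter_upwards [hs₁, hs₂] with s a₁ a₂ hs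
      have hs' : s ∈ Ioo 0 T := ⟨hs.1, hs.2.trans_le ht.2⟩
      have := hΨ.monotone_subdifferential (a₁ hs') (a₂ hs')
      simp only [sub_apply] at this ⊢
      linarith)
  rw [mul_zero, zero_mul, zero_mul] at key
  have h3 : ‖z₁ t - z₂ t‖ ^ 2 ≤ 0 := nonpos_of_mul_nonpos_right key h.pos
  exact sub_eq_zero.1 (norm_eq_zero.1 (pow_eq_zero_iff two_ne_zero |>.1
    (le_antisymm h3 (by positivity))))

end IsEllipticOperator

end Existence

/-! ### Reduction of the semilinear energy to the abstract setting. -/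

section Energy

variable {Z V : Type*} [NormedAddCommGroup Z] [InnerProductSpace ℝ Z]
  [NormedAddCommGroup V] [InnerProductSpace ℝ V]
  {ι : Z →L[ℝ] V} {A : Z →L[ℝ] StrongDual ℝ Z} {F : Z → ℝ} {ℓ : ℝ → StrongDual ℝ V} {T : ℝ}

theorem hasFDerivAt_quadratic_add (hA : ∀ u v : Z, A u v = A v u) (hF : ContDiff ℝ 2 F) (z : Z) :
    HasFDerivAt (fun z => (1 / 2 : ℝ) * A z z + F z) (A z + fderiv ℝ F z) z := by
  have h1 : HasFDerivAt (fun z => A z z) _ z := A.hasFDerivAt.clm_apply (hasFDerivAt_id z)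
  have h2 : HasFDerivAt F (fderiv ℝ F z) z := (hF.differentiable two_ne_zero z).hasFDerivAt
  refine ((h1.const_mul (1 / 2)).add h2).congr_fderiv ?_
  ext v
  simp [hA v z]
  ring

theorem energyDeriv_eq (hA : ∀ u v : Z, A u v = A v u) (hF : ContDiff ℝ 2 F) (t : ℝ) (z : Z) :
    energyDeriv ι A F ℓ t z = A z + fderiv ℝ F z - (ℓ t).comp ι :=
  ((hasFDerivAt_quadratic_add hA hF z).sub ((ℓ t).comp ι).hasFDerivAt).fderiv

theorem hasFDerivAt_add_fderiv (hF : ContDiff ℝ 2 F) (z : Z) :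
    HasFDerivAt (fun z => A z + fderiv ℝ F z) (A + fderiv ℝ (fderiv ℝ F) z) z := by
  have h1 : ContDiff ℝ 1 (fderiv ℝ F) := hF.fderiv_right (by norm_num)
  exact A.hasFDerivAt.add (h1.differentiable one_ne_zero z).hasFDerivAt

theorem energyDeriv2_eq (hA : ∀ u v : Z, A u v = A v u) (hF : ContDiff ℝ 2 F) (t : ℝ) (z : Z) :
    energyDeriv2 ι A F ℓ t z = A + fderiv ℝ (fderiv ℝ F) z := by
  have e1 : energyDeriv ι A F ℓ t = fun z => A z + fderiv ℝ F z - (ℓ t).comp ι :=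
    funext fun z => energyDeriv_eq hA hF t z
  rw [energyDeriv2, e1]
  exact ((hasFDerivAt_add_fderiv hF z).sub_const _).fderiv

/-- The load is linear in `z`, so the second derivative is independent of time and the hypotheses at
`t = 0` suffice. -/
theorem IsAdmissibleEnergy.isEllipticOperator {κ : ℝ} (hT : 0 ≤ T)
    (h : IsAdmissibleEnergy ι A F ℓ T) (hκ : IsUniformlyConvex ι A F ℓ T κ) :
    IsEllipticOperator (fun z => A z + fderiv ℝ F z) (fun z => A + fderiv ℝ (fderiv ℝ F) z) κ := by
  have h0 : (0 : ℝ) ∈ Icc 0 T := ⟨le_rfl, hT⟩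
  have e := energyDeriv2_eq (ι := ι) (ℓ := ℓ) h.symm h.contDiff 0
  refine ⟨hasFDerivAt_add_fderiv h.contDiff, fun z u v => ?_, hκ.1, fun z v => ?_, fun r hr => ?_⟩
  · have := (h.contDiff.contDiffAt (x := z)).isSymmSndFDerivAt (by simp) u v
    simp [h.symm u v, this]
  · rw [← e]
    exact hκ.2 0 h0 z v
  · obtain ⟨C, hC, hb⟩ := h.locLipschitz 0 h0 r hr
    simp only [e] at hb
    exact ⟨C, hC, hb⟩

theorem inclusion_iff {R : V → ℝ} (hR : IsSublinearPotential R) (hι : Function.Injective ι)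
    {t : ℝ} {w z : Z} : Inclusion ι A F ℓ R t w z ↔
      -energyDeriv ι A F ℓ t z ∈ subdifferential (fun v => R (ι v)) w := by
  rw [Inclusion, (hR.comp ι).mem_subdifferential_iff, add_singleton]
  constructor
  · rintro ⟨_, ⟨η, hη, rfl⟩, h0⟩
    rw [hR.mem_subdifferential_iff] at hη
    have e1 : -energyDeriv ι A F ℓ t z = η.comp ι := (eq_neg_of_add_eq_zero_left h0).symm
    rw [e1]
    exact ⟨fun v => hη.1 _, hη.2⟩
  · rintro ⟨h1, h2⟩
    obtain ⟨η, hη, e1⟩ := hR.exists_comp_eq hι h1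
    refine ⟨η.comp ι, ⟨η, hR.mem_subdifferential_iff.2 ⟨hη, ?_⟩, rfl⟩, by simp [e1]⟩
    have : η (ι w) = (η.comp ι) w := rfl
    rw [this, e1]
    exact h2

end Energy

end RateIndependent

/-! ### Assembly of existence, regularity and uniqueness. -/

theorem theoremB1
    {Z V X : Type*}
    [NormedAddCommGroup Z] [InnerProductSpace ℝ Z] [CompleteSpace Z]
    [NormedAddCommGroup V] [InnerProductSpace ℝ V] [CompleteSpace V]
    [NormedAddCommGroup X] [NormedSpace ℝ X] [CompleteSpace X]
    (ι : Z →L[ℝ] V) (j : V →L[ℝ] X) (hemb : RateIndependent.IsEmbeddingChain ι j)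
    (T : ℝ) (hT : 0 < T)
    (A : Z →L[ℝ] StrongDual ℝ Z) (F : Z → ℝ) (ℓ : ℝ → StrongDual ℝ V)
    (hI : RateIndependent.IsAdmissibleEnergy ι A F ℓ T)
    (R : V → ℝ) (hR : RateIndependent.IsAdmissibleDissipation j R)
    (z₀ : Z) (hz₀ : RateIndependent.Inclusion ι A F ℓ R 0 0 z₀)
    (κ : ℝ) (hconv : RateIndependent.IsUniformlyConvex ι A F ℓ T κ) :
    ∃ z : ℝ → Z,
      RateIndependent.IsDifferentialSolution ι A F ℓ R T z₀ z ∧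
      RateIndependent.MemSobolev ⊤ T z ∧
      ∀ w : ℝ → Z, RateIndependent.IsDifferentialSolution ι A F ℓ R T z₀ w →
        EqOn w z (Icc 0 T) := by
  have hell := hI.isEllipticOperator hT.le hconv
  have hRs := hR.isSublinearPotential
  have hΨ := hRs.comp ι
  obtain ⟨L, hL⟩ := hI.lipschitz_load
  -- The load is frozen outside `[0, T]`, keeping it globally Lipschitz; the scheme evaluates it at
  -- nodes past `T`.
  set l : ℝ → StrongDual ℝ Z := fun t => (ℓ (projIcc 0 T hT.le t)).comp ι with hl
  have hlLip : ∀ s t, ‖l t - l s‖ ≤ L * ‖ι‖ * |t - s| := by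
    intro s t
    have h1 := hL.dist_le_mul _ (projIcc 0 T hT.le t).2 _ (projIcc 0 T hT.le s).2
    have h2 : |(projIcc 0 T hT.le t : ℝ) - projIcc 0 T hT.le s| ≤ |t - s| :=
      abs_projIcc_sub_projIcc hT.le
    rw [dist_eq_norm, Real.dist_eq] at h1
    have e1 : l t - l s = (ℓ (projIcc 0 T hT.le t) - ℓ (projIcc 0 T hT.le s)).comp ι := by
      rw [ContinuousLinearMap.sub_comp]
    rw [e1]
    calc _ ≤ ‖ℓ (projIcc 0 T hT.le t) - ℓ (projIcc 0 T hT.le s)‖ * ‖ι‖ :=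
          ContinuousLinearMap.opNorm_comp_le _ _
      _ ≤ (L * |t - s|) * ‖ι‖ := by gcongr; exact h1.trans (by gcongr)
      _ = L * ‖ι‖ * |t - s| := by ring
  have hincl : ∀ t ∈ Icc 0 T, ∀ w z, RateIndependent.Inclusion ι A F ℓ R t w z ↔
      l t - (A z + fderiv ℝ F z) ∈ RateIndependent.subdifferential (fun v => R (ι v)) w := by
    intro t ht w z
    rw [RateIndependent.inclusion_iff hRs hemb.injective_left,
      RateIndependent.energyDeriv_eq hI.symm hI.contDiff, neg_sub, hl]
    simp only [projIcc_of_mem hT.le ht]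
  have h0 : (0 : ℝ) ∈ Icc 0 T := ⟨le_rfl, hT.le⟩
  obtain ⟨y, γ, Λ, hy0, hyγ, hγ, hsol⟩ := hell.exists_solution
    (RateIndependent.hasFDerivAt_quadratic_add hI.symm hI.contDiff) hΨ (by positivity) hT.le hlLip
    ((hincl 0 h0 _ _).1 hz₀)
  have hyc := hyγ.continuousOn hT.le
  have hγm := (hyγ.integrable hT.le).aestronglyMeasurable
  have hym : AEStronglyMeasurable y (volume.restrict (Ioo 0 T)) :=
    (hyc.mono Ioo_subset_Icc_self).aestronglyMeasurable measurableSet_Ioo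
  obtain ⟨C, hC⟩ := isCompact_Icc.exists_bound_of_continuousOn hyc
  have hSob : RateIndependent.IsSobolevWithDeriv ⊤ T y γ := by
    refine ⟨memLp_top_of_bound hym C ?_, memLp_top_of_bound hγm Λ ?_, hyγ.isWeakDeriv hT.le⟩
    · exact (ae_restrict_iff' measurableSet_Ioo).2
        (Filter.Eventually.of_forall fun t ht => hC t (Ioo_subset_Icc_self ht))
    · exact (ae_restrict_iff' measurableSet_Ioo).2 hγ
  refine ⟨y, ⟨hyc, hy0, γ, ⟨hSob.memLp.mono_exponent le_top, hSob.memLp_deriv.mono_exponent le_top,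
    hSob.isWeakDeriv⟩, ?_⟩, ⟨γ, hSob⟩, fun w hw => ?_⟩
  · rw [ae_restrict_iff' measurableSet_Ioo]
    filter_upwards [hsol] with t ht htT
    exact (hincl t (Ioo_subset_Icc_self htT) _ _).2 (ht htT)
  · obtain ⟨w', hw', hwi⟩ := hw.inclusion
    rw [ae_restrict_iff' measurableSet_Ioo] at hwi
    -- A competitor is merely `W^{1,1}`; being a primitive with integrable slope is enough, since
    -- Gronwall admits integrable coefficients.
    refine hell.solution_unique hΨ (hw'.isPrimitiveOn hT.le hw.continuousOn) hyγ
      (hw.initial.trans hy0.symm) ?_ hsol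
    filter_upwards [hwi] with t ht htT
    exact (hincl t (Ioo_subset_Icc_self htT) _ _).1 (ht htT)
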